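/- Let $p$ be a prime, $k$ a field of characteristic $p$, $X=k[x]/(x^p)$ and $\partial_x=d/dx\in\operatorname{Der}_k X$. For a Lie algebra $L$ over $k$ let $L\wr\operatorname{Der}X=(X\otimes_k L)\rtimes\operatorname{Der}_kX$, where derivations act on the first tensor factor. A Lie algebra homomorphism $\psi:L\to L\wr\operatorname{Der}X$ makes $L$ act on the tensor algebra $T(X)=\bigoplus_{n\ge0}X^{\otimes n}$ by $k$-linear maps: $a\cdot 1=0$ and $$a\cdot(x_1\otimes w)=\sum_i x_1y_i\otimes(a_i\cdot w)+\delta(x_1)\otimes w\qquad\text{if }\psi(a)=\sum_i y_i\otimes a_i+\delta .$$ Fix an integer $m\ge2$, let $F$ be the free Lie algebra over $k$ on $d_1,\dots,d_{m-1},v$, and let $\psi:F\to F\wr\operatorname{Der}X$ be the homomorphism with $$d_1\mapsto\partial_x,\qquad d_{n+1}\mapsto 1\otimes d_n\ (1\le n\le m-2),\qquad v\mapsto 1\otimes d_{m-1}+x^{p-1}\otimes v .$$ The Petrogradsky–Shestakov–Zelmanov algebra $L_{m,k}$ is the restricted Lie algebra of operators on $T(X)$ generated by the operators of $d_1,\dots,d_{m-1},v$,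 that is, the smallest Lie subalgebra of $\operatorname{End}_k(T(X))$ that contains them and is closed under the $p$-mapping $a\mapsto a^p$. Let $L^{\circ}_{m,k}$ be the Lie algebra defined by the same data without the $p$-mapping, that is, the quotient of $F$ by the kernel of its action on $T(X)$. **Theorem.** The algebra $L_{m,k}$ is nil but not nilpotent: for every $a\in L_{m,k}$ there is $n\in\mathbb N$ with $a^{p^n}=0$, and $\operatorname{ad}(a)$ is a nilpotent endomorphism of $L_{m,k}$; but $L_{m,k}$ is not a nilpotent Lie algebra. Likewise, $\operatorname{ad}(a)$ is a nilpotent endomorphism of $L^{\circ}_{m,k}$ for every $a\in L^{\circ}_{m,k}$, and $L^{\circ}_{m,k}$ is not a nilpotent Lie algebra. -/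

import Mathlib

open scoped TensorProduct

attribute [local instance 100] LieRing.ofAssociativeRing

noncomputable section

namespace SelfSimilar

/-! ### Wreath products and self-similarity structures -/

section General

variable (k X L : Type*) [CommRing k] [CommRing X] [Algebra k X] [LieRing L] [LieAlgebra k L]

/-- The wreath product `L ≀ Der X = (X ⊗ L) ⋊ Der X`, where derivations act on `X ⊗ L` by
deriving the first coordinate. -/
abbrev Wreath : Type _ :=
  LieAlgebra.SemiDirectSum (X ⊗[k] L) (Derivation k X X) (Lie.Derivation.ofDerivation (R := k) L)

variable {k X L}

/-- The element `y ⊗ a` of the wreath product. -/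
def Wreath.tmul (y : X) (a : L) : Wreath k X L := ⟨y ⊗ₜ[k] a, 0⟩

/-- The derivation `δ` as an element of the wreath product. -/
def Wreath.der (δ : Derivation k X X) : Wreath k X L := ⟨0, δ⟩

/-- The linear map `X ⊗ L → T(X)`, `y ⊗ a ↦ (x * y) ⊗ f a`. -/
def contract (f : L →ₗ[k] TensorAlgebra k X) (x : X) : X ⊗[k] L →ₗ[k] TensorAlgebra k X :=
  TensorProduct.lift
    ((LinearMap.mul k (TensorAlgebra k X)).compl₁₂
      (TensorAlgebra.ι k ∘ₗ LinearMap.mulLeft k x) f)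

@[simp] lemma contract_tmul (f : L →ₗ[k] TensorAlgebra k X) (x y : X) (a : L) :
    contract f x (y ⊗ₜ[k] a) = TensorAlgebra.ι k (x * y) * f a := by
  simp [contract]

lemma contract_add_left (f g : L →ₗ[k] TensorAlgebra k X) (x : X) :
    contract (f + g) x = contract f x + contract g x := by
  ext y a; simp [mul_add]

lemma contract_smul_left (c : k) (f : L →ₗ[k] TensorAlgebra k X) (x : X) :
    contract (c • f) x = c • contract f x := by
  ext y a; simp

lemma contract_add_right (f : L →ₗ[k] TensorAlgebra k X) (x y : X) :
    contract f (x + y) = contract f x + contract f y := by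
  ext z a; simp [add_mul]

lemma contract_smul_right (c : k) (f : L →ₗ[k] TensorAlgebra k X) (x : X) :
    contract f (c • x) = c • contract f x := by
  ext z a; simp

/-- One step of the recursion defining the natural action.  A pair `(f, w)` records a tensor
`w ∈ T(X)` together with the map `f : a ↦ a · w`; the letter `x` sends it to `x ⊗ w` together with
`a ↦ a · (x ⊗ w) = ∑ x yᵢ ⊗ (aᵢ · w) + δ x ⊗ w`, where `ψ a = ∑ yᵢ ⊗ aᵢ + δ`. -/
def actionStep (ψ : L →ₗ⁅k⁆ Wreath k X L) :
    X →ₗ[k] Module.End k ((L →ₗ[k] TensorAlgebra k X) × TensorAlgebra k X) where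
  toFun x :=
    { toFun := fun fw =>
        ({ toFun := fun a => contract fw.1 x (ψ a).left
              + TensorAlgebra.ι k ((ψ a).right x) * fw.2
           map_add' := fun a b => by simp [add_mul]; abel
           map_smul' := fun c a => by simp },
         TensorAlgebra.ι k x * fw.2)
      map_add' := fun fw gw => by
        ext a
        · simp [contract_add_left, mul_add]; abel
        · simp [mul_add]
      map_smul' := fun c fw => by
        ext a
        · simp [contract_smul_left]
        · simp }
  map_add' x y := by
    ext fw a
    all_goals simp [contract_add_right, add_mul] <;> abel
  map_smul' c x := by
    ext fw a
    all_goals simp [contract_smul_right]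

/-- For a tensor `w`, the pair consisting of `a ↦ a · w` and of `w`. The recursion starts
from the empty tensor `1`, on which every `a` acts by `0`. -/
def actionPair (ψ : L →ₗ⁅k⁆ Wreath k X L) :
    TensorAlgebra k X →ₗ[k] (L →ₗ[k] TensorAlgebra k X) × TensorAlgebra k X :=
  LinearMap.applyₗ (0, 1) ∘ₗ (TensorAlgebra.lift k (actionStep ψ)).toLinearMap

lemma actionPair_ι_mul (ψ : L →ₗ⁅k⁆ Wreath k X L) (x : X) (w : TensorAlgebra k X) :
    actionPair ψ (TensorAlgebra.ι k x * w) = actionStep ψ x (actionPair ψ w) := by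
  simp [actionPair]

lemma tensor_induction {P : TensorAlgebra k X → Prop} (one : P 1)
    (smul : ∀ (c : k) w, P w → P (c • w)) (add : ∀ v w, P v → P w → P (v + w))
    (ι_mul : ∀ x w, P w → P (TensorAlgebra.ι k x * w)) (w : TensorAlgebra k X) : P w := by
  have h : ∀ u : TensorAlgebra k X, ∀ w, P w → P (u * w) := by
    intro u
    induction u using TensorAlgebra.induction with
    | algebraMap r => intro w hw; rw [← Algebra.smul_def]; exact smul r w hw
    | ι x => intro w hw; exact ι_mul x w hw
    | mul a b ha hb => intro w hw; rw [mul_assoc]; exact ha _ (hb _ hw)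
    | add a b ha hb => intro w hw; rw [add_mul]; exact add _ _ (ha _ hw) (hb _ hw)
  simpa using h w 1 one

lemma actionPair_snd (ψ : L →ₗ⁅k⁆ Wreath k X L) (w : TensorAlgebra k X) :
    (actionPair ψ w).2 = w := by
  induction w using tensor_induction with
  | one => simp [actionPair]
  | smul c w hw => simp [hw]
  | add v w hv hw => simp [hv, hw]
  | ι_mul x w hw => rw [actionPair_ι_mul]; simp [actionStep, hw]

/-- The linear operators through which the elements of `L` act on `T(X)`. -/
def actionLin (ψ : L →ₗ⁅k⁆ Wreath k X L) : L →ₗ[k] Module.End k (TensorAlgebra k X) :=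
  (LinearMap.fst k _ _ ∘ₗ actionPair ψ).flip

lemma actionLin_one (ψ : L →ₗ⁅k⁆ Wreath k X L) (a : L) : actionLin ψ a 1 = 0 := by
  simp [actionLin, actionPair]

lemma actionLin_ι_mul (ψ : L →ₗ⁅k⁆ Wreath k X L) (a : L) (x : X) (w : TensorAlgebra k X) :
    actionLin ψ a (TensorAlgebra.ι k x * w) =
      contract ((actionLin ψ).flip w) x (ψ a).left
        + TensorAlgebra.ι k ((ψ a).right x) * w := by
  have h : (actionPair ψ w).1 = (actionLin ψ).flip w := rfl
  simp only [actionLin, LinearMap.flip_apply, LinearMap.comp_apply, LinearMap.fst_apply,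
    actionPair_ι_mul]
  simp [actionStep, actionPair_snd, h]

/-- The map `v ↦ ∑ x y z ⊗ c · (b · w)`, for `v = ∑ y ⊗ b` and `u = ∑ z ⊗ c`. -/
def contractTwo (ψ : L →ₗ⁅k⁆ Wreath k X L) (w : TensorAlgebra k X) (x : X) (u : X ⊗[k] L) :
    X ⊗[k] L →ₗ[k] TensorAlgebra k X :=
  TensorProduct.lift (LinearMap.mk₂ k
    (fun y b => contract ((actionLin ψ).flip (actionLin ψ b w)) (x * y) u)
    (fun y z b => by simp [mul_add, contract_add_right])
    (fun c y b => by simp [contract_smul_right])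
    (fun y b c => by simp [contract_add_left])
    (fun c y b => by simp [contract_smul_left]))

lemma contractTwo_tmul (ψ : L →ₗ⁅k⁆ Wreath k X L) (w : TensorAlgebra k X) (x y : X)
    (u : X ⊗[k] L) (b : L) : contractTwo ψ w x u (y ⊗ₜ[k] b) =
      contract ((actionLin ψ).flip (actionLin ψ b w)) (x * y) u := by
  simp [contractTwo]

lemma contractTwo_add (ψ : L →ₗ⁅k⁆ Wreath k X L) (w : TensorAlgebra k X) (x : X)
    (u u' v : X ⊗[k] L) :
    contractTwo ψ w x (u + u') v = contractTwo ψ w x u v + contractTwo ψ w x u' v := by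
  induction v using TensorProduct.induction_on with
  | zero => simp
  | tmul y b => simp [contractTwo_tmul]
  | add v v' h h' => simp only [map_add, h, h']; abel

lemma contractTwo_zero (ψ : L →ₗ⁅k⁆ Wreath k X L) (w : TensorAlgebra k X) (x : X)
    (v : X ⊗[k] L) : contractTwo ψ w x 0 v = 0 := by
  simpa using contractTwo_add ψ w x 0 0 v

lemma actionLin_contract (ψ : L →ₗ⁅k⁆ Wreath k X L) (a : L) (w : TensorAlgebra k X)
    (x : X) (v : X ⊗[k] L) :
    actionLin ψ a (contract ((actionLin ψ).flip w) x v) =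
      contractTwo ψ w x (ψ a).left v
        + contract ((actionLin ψ).flip w) x (Lie.Derivation.ofDerivation L (ψ a).right v)
        + contract ((actionLin ψ).flip w) ((ψ a).right x) v := by
  induction v using TensorProduct.induction_on with
  | zero => simp
  | tmul y b =>
    simp [actionLin_ι_mul, contractTwo_tmul, add_mul, mul_comm y]
    abel
  | add u v hu hv => simp only [map_add, hu, hv]; abel

lemma contract_lie (ψ : L →ₗ⁅k⁆ Wreath k X L) (w : TensorAlgebra k X)
    (hw : ∀ a b : L, actionLin ψ ⁅a, b⁆ w =
      actionLin ψ a (actionLin ψ b w) - actionLin ψ b (actionLin ψ a w))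
    (x : X) (u v : X ⊗[k] L) :
    contract ((actionLin ψ).flip w) x ⁅u, v⁆ =
      contractTwo ψ w x u v - contractTwo ψ w x v u := by
  induction v using TensorProduct.induction_on with
  | zero => simp [contractTwo_zero]
  | add v v' h h' => simp only [lie_add, map_add, contractTwo_add, h, h']; abel
  | tmul y b =>
    induction u using TensorProduct.induction_on with
    | zero => simp [contractTwo_zero]
    | add v v' h h' => simp only [add_lie, map_add, contractTwo_add, h, h']; abel
    | tmul z a =>
      simp only [LieAlgebra.ExtendScalars.bracket_tmul, contractTwo_tmul, contract_tmul,
        LinearMap.flip_apply, hw, mul_sub, mul_assoc, mul_comm z y]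

lemma actionLin_lie (ψ : L →ₗ⁅k⁆ Wreath k X L) (w : TensorAlgebra k X) : ∀ a b : L,
    actionLin ψ ⁅a, b⁆ w =
      actionLin ψ a (actionLin ψ b w) - actionLin ψ b (actionLin ψ a w) := by
  induction w using tensor_induction with
  | one => simp [actionLin_one]
  | smul c w hw => intro a b; simp [hw, smul_sub]
  | add v w hv hw => intro a b; simp only [map_add, hv, hw]; abel
  | ι_mul x w hw =>
    intro a b
    simp only [actionLin_ι_mul, map_add, actionLin_contract, LieHom.map_lie,
      LieAlgebra.SemiDirectSum.lie_eq_mk, map_sub, contract_lie ψ w hw,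
      Derivation.commutator_apply, sub_mul]
    abel

/-- The natural action of a self-similar Lie algebra `(L, ψ)` on `T(X)`, namely
`a · 1 = 0` and `a · (x ⊗ w) = ∑ x yᵢ ⊗ (aᵢ · w) + δ x ⊗ w` if `ψ a = ∑ yᵢ ⊗ aᵢ + δ`
(see `naturalAction_one` and `naturalAction_ι_mul`). -/
def naturalAction (ψ : L →ₗ⁅k⁆ Wreath k X L) : L →ₗ⁅k⁆ Module.End k (TensorAlgebra k X) where
  toLinearMap := actionLin ψ
  map_lie' := by
    intro a b
    ext1 w
    exact actionLin_lie ψ w a b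

lemma naturalAction_one (ψ : L →ₗ⁅k⁆ Wreath k X L) (a : L) : naturalAction ψ a 1 = 0 :=
  actionLin_one ψ a

lemma naturalAction_ι_mul (ψ : L →ₗ⁅k⁆ Wreath k X L) (a : L) (x : X) (w : TensorAlgebra k X) :
    naturalAction ψ a (TensorAlgebra.ι k x * w) =
      contract ((naturalAction ψ : L →ₗ[k] Module.End k (TensorAlgebra k X)).flip w) x (ψ a).left
        + TensorAlgebra.ι k ((ψ a).right x) * w :=
  actionLin_ι_mul ψ a x w

end General

/-! ### Self-similar Lie algebras given by generators -/

section Generated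

variable {k X ι : Type*} [CommRing k] [CommRing X] [Algebra k X]

/-- The self-similarity structure on the free Lie algebra determined by the images of the
generators. -/
def freeStructure (g : ι → Wreath k X (FreeLieAlgebra k ι)) :
    FreeLieAlgebra k ι →ₗ⁅k⁆ Wreath k X (FreeLieAlgebra k ι) :=
  FreeLieAlgebra.lift k g

/-- The self-similar Lie algebra (without `p`-mapping) defined by the data `g`: the quotient of the
free Lie algebra by the kernel of its natural action on `T(X)`. -/
abbrev DefinedAlgebra (g : ι → Wreath k X (FreeLieAlgebra k ι)) : Type _ :=
  FreeLieAlgebra k ι ⧸ (naturalAction (freeStructure g)).ker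

/-- The restricted Lie subalgebra generated by a subset `S` of an associative algebra `A` (in
characteristic `p`): the smallest Lie subalgebra containing `S` and closed under `a ↦ a ^ p`. -/
def restrictedClosure {A : Type*} [Ring A] [Algebra k A] (p : ℕ) (S : Set A) :
    LieSubalgebra k A :=
  sInf {H : LieSubalgebra k A | S ⊆ H ∧ ∀ a ∈ H, a ^ p ∈ H}

/-- The restricted self-similar Lie algebra defined by the data `g`: the restricted Lie algebra of
operators on `T(X)` generated by the operators of the generators. Its `p`-mapping is `a ↦ a ^ p`. -/
def definedRestrictedAlgebra (p : ℕ) (g : ι → Wreath k X (FreeLieAlgebra k ι)) :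
    LieSubalgebra k (Module.End k (TensorAlgebra k X)) :=
  restrictedClosure p
    (Set.range fun i : ι => naturalAction (freeStructure g) (FreeLieAlgebra.of k i))

end Generated

/-! ### The Petrogradsky-Shestakov-Zelmanov algebras -/

section PSZ

open Polynomial

variable (p : ℕ) (k : Type*) [Field k]

/-- The alphabet `k[x]/(x ^ p)`. -/
abbrev Alphabet : Type _ := k[X] ⧸ Ideal.span {(X : k[X]) ^ p}

/-- The class of `x` in `k[x]/(x ^ p)`. -/
def Alphabet.x : Alphabet p k := Ideal.Quotient.mk _ X

variable [CharP k p]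

/-- The derivation `d/dx` of `k[x]/(x ^ p)`, which exists because `k` has characteristic `p`. -/
def Alphabet.ddx : Derivation k (Alphabet p k) (Alphabet p k) :=
  Derivation.liftOfSurjective (f := Ideal.Quotient.mkₐ k (Ideal.span {(X : k[X]) ^ p}))
    (Ideal.Quotient.mkₐ_surjective k _) (d := Polynomial.derivative') <| by
      intro f hf
      simp only [Ideal.Quotient.mkₐ_eq_mk, Ideal.Quotient.eq_zero_iff_mem,
        Ideal.mem_span_singleton] at hf ⊢
      obtain ⟨h, rfl⟩ := hf
      simp

lemma Alphabet.ddx_mk (f : k[X]) :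
    Alphabet.ddx p k (Ideal.Quotient.mk _ f) = Ideal.Quotient.mk _ (derivative f) := by
  unfold Alphabet.ddx
  exact Derivation.liftOfSurjective_apply
    (f := Ideal.Quotient.mkₐ k (Ideal.span {(X : k[X]) ^ p}))
    (Ideal.Quotient.mkₐ_surjective k _) (d := Polynomial.derivative') _ f

/-- The generators `d₁, …, d_{m-1}, v`. -/
inductive Gen (m : ℕ) : Type
  | d (n : ℕ) (h₁ : 1 ≤ n) (h₂ : n < m) : Gen m
  | v : Gen m

/-- The self-similarity structure on the generators: `d₁ ↦ ∂ₓ`, `d_{n+1} ↦ 1 ⊗ dₙ` for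
`1 ≤ n ≤ m - 2`, and `v ↦ 1 ⊗ d_{m-1} + x ^ (p-1) ⊗ v`. -/
def pszStructure (m : ℕ) (hm : 2 ≤ m) :
    Gen m → Wreath k (Alphabet p k) (FreeLieAlgebra k (Gen m))
  | .d 0 h₁ _ => absurd h₁ (by decide)
  | .d 1 _ _ => Wreath.der (Alphabet.ddx p k)
  | .d (n + 2) _ h₂ =>
      Wreath.tmul 1 (FreeLieAlgebra.of k (.d (n + 1) (by omega) (by omega)))
  | .v =>
      Wreath.tmul 1 (FreeLieAlgebra.of k (.d (m - 1) (by omega) (by omega)))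
        + Wreath.tmul (Alphabet.x p k ^ (p - 1)) (FreeLieAlgebra.of k .v)

/-- The Petrogradsky-Shestakov-Zelmanov algebra `L_{m,k}`, as a restricted Lie algebra. -/
abbrev pszRestricted (m : ℕ) (hm : 2 ≤ m) :
    LieSubalgebra k (Module.End k (TensorAlgebra k (Alphabet p k))) :=
  definedRestrictedAlgebra p (pszStructure p k m hm)

/-- The Petrogradsky-Shestakov-Zelmanov algebra `L_{m,k}`, generated as a Lie algebra without
using the `p`-mapping. -/
abbrev PSZPlain (m : ℕ) (hm : 2 ≤ m) : Type _ :=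
  DefinedAlgebra (pszStructure p k m hm)

end PSZ

/-- A Lie algebra `L` is nil if `ad a` is a nilpotent endomorphism of `L` for every `a ∈ L`. -/
def IsAdNil (k L : Type*) [CommRing k] [LieRing L] [LieAlgebra k L] : Prop :=
  ∀ a : L, IsNilpotent (LieAlgebra.ad k L a)

end SelfSimilar

end

noncomputable section

namespace SelfSimilar

/-! ### Powers of derivations in characteristic `p` -/

section DerivationPower

variable {K A : Type*} [CommRing K] [CommRing A] [Algebra K A] (p : ℕ) [Fact p.Prime] [CharP K p]

/-! Reading `y₀ ⊗ ⋯ ⊗ yₙ₋₁` as `tⁿ y₀(x₀) ⋯ yₙ₋₁(xₙ₋₁)` embeds `T(X)` into the truncated polynomials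
in `x₀, x₁, …` over `k[t]` (`realize_injective`). There `d_{n+1}` becomes `∂/∂xₙ` and `v` becomes `∑
(x₀ ⋯ xⱼ₋₁)^(p-1) ∂/∂x_{j+m-1}`.

Nil: give `xᵢ` weight `λ^i`, where `λ > 1` solves `λ^(m-1) (λ-1) = p-1`; this makes `v` homogeneous.
Consider triangular derivations that lower weights by an amount in some `[c, d]`. Because exponents
stay below `p`, the lower bound `c = 1` is automatic (`LowersBy.one`), so those with `c = 1` are
closed under brackets and `p`-th powers and their operators contain the whole restricted algebra.
They are nilpotent (`LowersBy.isNilpotent`) because the ratio `d/c` can be driven down. If `D` has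
bounds `[1, d]`, then `D^p` has bounds `[p+λ-1, p d]`, so the ratio shrinks by the factor `p/(p+λ-1)
< 1`. As long as `c > 1`, the derivation kills `x₀`; setting `x₀ = 0` and renumbering divides both
bounds by `λ` and does not affect nilpotency. Once `c ≤ 1`, it may be raised to `1` for free. After
finitely many rounds `d < 1`, which forces the derivation to be zero. A nilpotent operator has
nilpotent `ad`, and the algebra without `p`-mapping embeds in the restricted one.

Not nilpotent: the endomorphism `φ` = `substitution` of the free Lie algebra is undone by setting `x
= 0` in the first letter (`tailMap_pszAction_substitution`), so `φ a` acts nontrivially whenever `a`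
does. As `φ v` is a multiple of `(ad d₁)^(p-1) v`, the element `φⁿ v` lies in the `n`-th term of the
lower central series, and it never acts as zero. -/

lemma derivation_pow_char_mul (D : Derivation K A A) (a b : A) :
    ((D : A →ₗ[K] A) ^ p) (a * b) =
      a * ((D : A →ₗ[K] A) ^ p) b + b * ((D : A →ₗ[K] A) ^ p) a := by
  set d : Module.End K A := (D : A →ₗ[K] A) with hd
  set l : Module.End K (Module.End K A) := LinearMap.mulLeft K d with hl
  set r : Module.End K (Module.End K A) := LinearMap.mulRight K d with hr
  have hlr : Commute l r := LinearMap.commute_mulLeft_right d d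
  have hp0 : (p : Module.End K (Module.End K A)) = 0 := by
    rw [← map_natCast (algebraMap K (Module.End K (Module.End K A))), CharP.cast_eq_zero, map_zero]
  -- `l - r` is `ad d`, which turns multiplication by `x` into multiplication by `d x`. Additivity
  -- of the `p`-th power on commuting elements then gives the Leibniz rule for `d ^ p`.
  have hpow : l ^ p = (l - r) ^ p + r ^ p := by
    obtain ⟨c, hc⟩ := (hlr.sub_left (Commute.refl r)).exists_add_pow_prime_eq
      (Fact.out : p.Prime)
    simpa [hp0] using hc
  have hstep : ∀ (j : ℕ) (x : A), ((l - r) ^ j) (LinearMap.mulLeft K x) =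
      LinearMap.mulLeft K ((d ^ j) x) := by
    intro j x
    induction j with
    | zero => simp
    | succ j ih =>
      rw [pow_succ', Module.End.mul_apply, ih, pow_succ' d, Module.End.mul_apply]
      ext y
      simp [hl, hr, hd, mul_comm]
  have h := congr($hpow (LinearMap.mulLeft K a) b)
  rw [LinearMap.add_apply, hstep, hl, hr, LinearMap.pow_mulLeft, LinearMap.pow_mulRight] at h
  simp only [LinearMap.mulLeft_apply, LinearMap.mulRight_apply, LinearMap.add_apply,
    Module.End.mul_apply] at h
  rw [h, mul_comm b, add_comm]

/-- The `p`-th power of a derivation in characteristic `p`. -/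
def derivationPow (D : Derivation K A A) : Derivation K A A :=
  Derivation.mk' ((D : A →ₗ[K] A) ^ p) fun a b => by
    simpa using derivation_pow_char_mul p D a b

lemma coe_derivationPow (D : Derivation K A A) :
    (derivationPow p D : A →ₗ[K] A) = (D : A →ₗ[K] A) ^ p := rfl

lemma derivationPow_apply (D : Derivation K A A) (a : A) :
    derivationPow p D a = ((D : A →ₗ[K] A) ^ p) a := rfl

end DerivationPower

/-! ### Truncated polynomials in countably many variables -/

open MvPolynomial in
/-- The truncated polynomial algebra `K[x₀, x₁, …]/(xᵢ ^ p)`. -/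
abbrev TruncPoly (p : ℕ) (K : Type*) [CommRing K] : Type _ :=
  MvPolynomial ℕ K ⧸ Ideal.span (Set.range fun i : ℕ => (X i : MvPolynomial ℕ K) ^ p)

namespace TruncPoly

variable (p : ℕ) (K : Type*) [CommRing K]

/-- The monomial with exponents `α`. -/
def mon (α : ℕ →₀ ℕ) : TruncPoly p K := Ideal.Quotient.mk _ (MvPolynomial.monomial α 1)

/-- The variable `xᵢ`. -/
def var (i : ℕ) : TruncPoly p K := Ideal.Quotient.mk _ (MvPolynomial.X i)

lemma mon_zero : mon p K 0 = 1 := by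
  simp [mon]

lemma mon_add (α β : ℕ →₀ ℕ) : mon p K (α + β) = mon p K α * mon p K β := by
  rw [mon, mon, mon, ← map_mul, MvPolynomial.monomial_mul, one_mul]

lemma mon_single (i n : ℕ) : mon p K (Finsupp.single i n) = var p K i ^ n := by
  rw [mon, var, ← map_pow, MvPolynomial.X_pow_eq_monomial]

lemma var_pow (i : ℕ) : var p K i ^ p = 0 := by
  rw [var, ← map_pow, Ideal.Quotient.eq_zero_iff_mem]
  exact Ideal.subset_span ⟨i, rfl⟩

lemma mon_eq_zero {α : ℕ →₀ ℕ} {i : ℕ} (h : p ≤ α i) : mon p K α = 0 := by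
  have : α = Finsupp.single i p + (α - Finsupp.single i p) := by
    ext j
    by_cases hj : i = j
    · subst hj; simp; omega
    · simp [Finsupp.single_eq_of_ne' hj]
  rw [this, mon_add, mon_single, var_pow, zero_mul]

lemma adjoin_range_var : Algebra.adjoin K (Set.range (var p K)) = ⊤ := by
  have h := MvPolynomial.adjoin_range_X (R := K) (σ := ℕ)
  have := congr(Subalgebra.map (Ideal.Quotient.mkₐ K
    (Ideal.span (Set.range fun i : ℕ => (MvPolynomial.X i : MvPolynomial ℕ K) ^ p))) $h)
  rw [AlgHom.map_adjoin, ← Set.range_comp, Algebra.map_top,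
    (AlgHom.range_eq_top _).2 (Ideal.Quotient.mkₐ_surjective _ _)] at this
  exact this

variable {p K}

lemma algHom_ext {B : Type*} [Semiring B] [Algebra K B] {f g : TruncPoly p K →ₐ[K] B}
    (h : ∀ i, f (var p K i) = g (var p K i)) : f = g :=
  AlgHom.ext_of_adjoin_eq_top (adjoin_range_var p K) (by rintro _ ⟨i, rfl⟩; exact h i)

lemma derivation_ext {D E : Derivation K (TruncPoly p K) (TruncPoly p K)}
    (h : ∀ i, D (var p K i) = E (var p K i)) : D = E :=
  Derivation.ext_of_adjoin_eq_top _ (adjoin_range_var p K) (by rintro _ ⟨i, rfl⟩; exact h i)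

lemma induction {P : TruncPoly p K → Prop} (algebraMap : ∀ c, P (algebraMap K _ c))
    (var : ∀ i, P (var p K i)) (add : ∀ f g, P f → P g → P (f + g))
    (mul : ∀ f g, P f → P g → P (f * g)) (f : TruncPoly p K) : P f := by
  have hf : f ∈ Algebra.adjoin K (Set.range (TruncPoly.var p K)) := by
    rw [adjoin_range_var]; trivial
  induction hf using Algebra.adjoin_induction with
  | mem x hx => obtain ⟨i, rfl⟩ := hx; exact var i
  | algebraMap r => exact algebraMap r
  | add x y _ _ hx hy => exact add x y hx hy
  | mul x y _ _ hx hy => exact mul x y hx hy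

/-- The algebra homomorphism with prescribed values on the variables. -/
def lift {B : Type*} [CommRing B] [Algebra K B] (g : ℕ → B) (hg : ∀ i, g i ^ p = 0) :
    TruncPoly p K →ₐ[K] B :=
  Ideal.Quotient.liftₐ _ (MvPolynomial.aeval g) <| by
    intro a ha
    have : Ideal.span (Set.range fun i : ℕ => (MvPolynomial.X i : MvPolynomial ℕ K) ^ p) ≤
        RingHom.ker (MvPolynomial.aeval g : MvPolynomial ℕ K →ₐ[K] B) := by
      rw [Ideal.span_le]
      rintro _ ⟨i, rfl⟩
      simp [hg]
    exact RingHom.mem_ker.1 (this ha)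

@[simp] lemma lift_var {B : Type*} [CommRing B] [Algebra K B] (g : ℕ → B) (hg : ∀ i, g i ^ p = 0)
    (i : ℕ) : lift g hg (var p K i) = g i := by
  exact MvPolynomial.aeval_X g i

/-- The derivation with prescribed values on the variables. -/
def der [CharP K p] (g : ℕ → TruncPoly p K) : Derivation K (TruncPoly p K) (TruncPoly p K) :=
  Derivation.liftOfSurjective (f := Ideal.Quotient.mkₐ K
      (Ideal.span (Set.range fun i : ℕ => (MvPolynomial.X i : MvPolynomial ℕ K) ^ p)))
    (Ideal.Quotient.mkₐ_surjective K _)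
    (d := MvPolynomial.mkDerivation K fun i => Quotient.out (g i)) <| by
      intro f hf
      simp only [Ideal.Quotient.mkₐ_eq_mk, Ideal.Quotient.eq_zero_iff_mem] at hf ⊢
      induction hf using Submodule.span_induction with
      | mem x hx =>
        obtain ⟨i, rfl⟩ := hx
        simp [Derivation.leibniz_pow]
      | zero => simp
      | add x y _ _ hx hy => rw [map_add]; exact add_mem hx hy
      | smul a x hx hdx =>
        rw [smul_eq_mul, Derivation.leibniz]
        exact add_mem (Ideal.mul_mem_left _ _ hdx) (Ideal.mul_mem_right _ _ hx)

@[simp] lemma der_var [CharP K p] (g : ℕ → TruncPoly p K) (i : ℕ) : der g (var p K i) = g i := by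
  unfold der
  refine (Derivation.liftOfSurjective_apply
    (f := Ideal.Quotient.mkₐ K
      (Ideal.span (Set.range fun i : ℕ => (MvPolynomial.X i : MvPolynomial ℕ K) ^ p)))
    (Ideal.Quotient.mkₐ_surjective K _) _ _).trans ?_
  rw [MvPolynomial.mkDerivation_X]
  exact Quotient.out_eq (g i)

/-- The homomorphism `xᵢ ↦ xᵢ₊₁`. -/
def shift : TruncPoly p K →ₐ[K] TruncPoly p K := lift (fun i => var p K (i + 1)) fun _ => var_pow p K _

@[simp] lemma shift_var (i : ℕ) : shift (var p K i) = var p K (i + 1) := lift_var _ _ _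

/-- The homomorphism `x₀ ↦ 0`, `xᵢ₊₁ ↦ xᵢ`. -/
def unshift [Fact p.Prime] : TruncPoly p K →ₐ[K] TruncPoly p K :=
  lift (fun i => Nat.casesOn i 0 (var p K)) <| by
    rintro (_ | i)
    · exact zero_pow (Fact.out : p.Prime).ne_zero
    · exact var_pow p K i

@[simp] lemma unshift_var_zero [Fact p.Prime] : unshift (var p K 0) = 0 := lift_var _ _ _

@[simp] lemma unshift_var_succ [Fact p.Prime] (i : ℕ) :
    unshift (var p K (i + 1)) = var p K i := lift_var _ _ _

/-- Every `f` is congruent to `shift (unshift f)` modulo `x₀`; this passes to sums and products, so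
it is enough to see it on constants and variables. -/
lemma var_zero_dvd_of_unshift_eq_zero [Fact p.Prime] {f : TruncPoly p K} (hf : unshift f = 0) :
    var p K 0 ∣ f := by
  have h : ∀ f : TruncPoly p K, var p K 0 ∣ f - shift (unshift f) := by
    intro f
    induction f using induction with
    | algebraMap c => simp
    | var i => cases i <;> simp
    | add f g hf hg =>
      rw [map_add, map_add, add_sub_add_comm]
      exact dvd_add hf hg
    | mul f g hf hg =>
      have : f * g - shift (unshift f) * shift (unshift g) =
          (f - shift (unshift f)) * g + shift (unshift f) * (g - shift (unshift g)) := by ring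
      rw [map_mul, map_mul, this]
      exact dvd_add (hf.mul_right _) (hg.mul_left _)
  simpa [hf] using h f

end TruncPoly

namespace TruncPoly

/-! ### Weights -/

section Weights

variable {p : ℕ} {K : Type*} [CommRing K] {lam : ℝ} {m : ℕ}

/-- The weight of a monomial, where `xᵢ` has weight `lam ^ i`. -/
def wt (lam : ℝ) : (ℕ →₀ ℕ) →+ ℝ := Finsupp.weight fun i => lam ^ i

@[simp] lemma wt_single (i e : ℕ) : wt lam (Finsupp.single i e) = e * lam ^ i := by
  simp [wt, Finsupp.weight_single]

lemma wt_nonneg (hlam : 0 ≤ lam) (α : ℕ →₀ ℕ) : 0 ≤ wt lam α := by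
  rw [wt, Finsupp.weight_apply]
  exact Finsupp.sum_nonneg fun i _ => by positivity

lemma wt_eq_sum {n : ℕ} {α : ℕ →₀ ℕ} (h : ∀ i, n ≤ i → α i = 0) :
    wt lam α = ∑ i ∈ Finset.range n, α i * lam ^ i := by
  rw [wt, Finsupp.weight_apply, Finsupp.sum_of_support_subset (s := Finset.range n)]
  · simp
  · intro i hi
    rw [Finset.mem_range]
    by_contra hn
    exact (Finsupp.mem_support_iff.1 hi) (h i (not_lt.1 hn))
  · simp

variable (p K lam) in
/-- The span of the monomials in `x₀, …, xₙ₋₁` whose weight lies in `[a, b]`. -/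
def wtSpan (n : ℕ) (a b : ℝ) : Submodule K (TruncPoly p K) :=
  Submodule.span K (mon p K '' {α | (∀ i, n ≤ i → α i = 0) ∧ a ≤ wt lam α ∧ wt lam α ≤ b})

lemma mon_mem_wtSpan {n : ℕ} {a b : ℝ} {α : ℕ →₀ ℕ} (h : ∀ i, n ≤ i → α i = 0)
    (ha : a ≤ wt lam α) (hb : wt lam α ≤ b) : mon p K α ∈ wtSpan p K lam n a b :=
  Submodule.subset_span ⟨α, ⟨h, ha, hb⟩, rfl⟩

lemma wtSpan_mono {n n' : ℕ} {a a' b b' : ℝ} (hn : n ≤ n') (ha : a' ≤ a) (hb : b ≤ b') :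
    wtSpan p K lam n a b ≤ wtSpan p K lam n' a' b' := by
  refine Submodule.span_mono (Set.image_mono ?_)
  rintro α ⟨h, h1, h2⟩
  exact ⟨fun i hi => h i (hn.trans hi), ha.trans h1, h2.trans hb⟩

lemma mul_mem_wtSpan {n : ℕ} {a b a' b' : ℝ} {f g : TruncPoly p K} (hf : f ∈ wtSpan p K lam n a b)
    (hg : g ∈ wtSpan p K lam n a' b') : f * g ∈ wtSpan p K lam n (a + a') (b + b') := by
  have h := Submodule.mul_mem_mul hf hg
  rw [wtSpan, wtSpan, Submodule.span_mul_span] at h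
  refine Submodule.span_mono ?_ h
  rintro _ ⟨_, ⟨α, ⟨h, h1, h2⟩, rfl⟩, _, ⟨β, ⟨h', h1', h2'⟩, rfl⟩, rfl⟩
  refine ⟨α + β, ⟨fun i hi => by simp [h i hi, h' i hi], ?_, ?_⟩, mon_add p K α β⟩
  · rw [map_add]; exact add_le_add h1 h1'
  · rw [map_add]; exact add_le_add h2 h2'

/-- `D` lowers weights by an amount in `[c, d]`, and the coefficient of `∂ / ∂ xᵢ` in `D` only
involves the variables `xⱼ` with `j + m ≤ i`. -/
def LowersBy (lam : ℝ) (m : ℕ) (D : Derivation K (TruncPoly p K) (TruncPoly p K)) (c d : ℝ) : Prop :=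
  ∀ i, D (var p K i) ∈ wtSpan p K lam (i + 1 - m) (lam ^ i - d) (lam ^ i - c)

variable {D E : Derivation K (TruncPoly p K) (TruncPoly p K)} {c d : ℝ}

lemma LowersBy.mono {c' d' : ℝ} (h : LowersBy lam m D c d) (hc : c' ≤ c) (hd : d ≤ d') :
    LowersBy lam m D c' d' :=
  fun i => wtSpan_mono le_rfl (by linarith) (by linarith) (h i)

lemma LowersBy.add (hD : LowersBy lam m D c d) (hE : LowersBy lam m E c d) :
    LowersBy lam m (D + E) c d := fun i => add_mem (hD i) (hE i)

lemma LowersBy.smul (a : K) (hD : LowersBy lam m D c d) : LowersBy lam m (a • D) c d :=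
  fun i => Submodule.smul_mem _ a (hD i)

lemma LowersBy.apply_mon (hm : 1 ≤ m) (h : LowersBy lam m D c d) (n : ℕ) (α : ℕ →₀ ℕ)
    (hα : ∀ i, n ≤ i → α i = 0) :
    D (mon p K α) ∈ wtSpan p K lam n (wt lam α - d) (wt lam α - c) := by
  have key : ∀ α : ℕ →₀ ℕ, (∀ i, n ≤ i → α i = 0) → D (mon p K α) ∈
      wtSpan p K lam n (wt lam α - d) (wt lam α - c) → ∀ j < n,
      D (mon p K (Finsupp.single j 1 + α)) ∈ wtSpan p K lam n
        (wt lam (Finsupp.single j 1 + α) - d) (wt lam (Finsupp.single j 1 + α) - c) := by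
    intro α hα hD j hj
    have hsupp : ∀ i, n ≤ i → (Finsupp.single j 1 : ℕ →₀ ℕ) i = 0 := fun i hi =>
      Finsupp.single_eq_of_ne (by omega)
    have h1 := mul_mem_wtSpan (mon_mem_wtSpan (K := K) (p := p) hsupp
      (le_refl (wt lam (Finsupp.single j 1))) le_rfl) hD
    -- Triangularity with `1 ≤ m` ensures that `D xⱼ` involves no variable beyond the first `n`.
    have h2 := mul_mem_wtSpan (mon_mem_wtSpan (K := K) (p := p) hα
      (le_refl (wt lam α)) le_rfl) (wtSpan_mono (by omega : j + 1 - m ≤ n) le_rfl le_rfl (h j))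
    rw [mon_add, Derivation.leibniz, mon_single, pow_one, map_add, smul_eq_mul, smul_eq_mul]
    rw [mon_single, pow_one] at h1
    simp only [wt_single, Nat.cast_one, one_mul] at h1 ⊢
    exact add_mem (wtSpan_mono le_rfl (by linarith) (by linarith) h1)
      (wtSpan_mono le_rfl (by linarith) (by linarith) h2)
  induction α using Finsupp.induction with
  | zero => rw [mon_zero, Derivation.map_one_eq_zero]; exact zero_mem _
  | single_add j e α hj he ih =>
    have hjn : j < n := by
      by_contra hn
      have := hα j (not_lt.1 hn)
      simp at this
      omega
    have hα' : ∀ i, n ≤ i → α i = 0 := fun i hi => by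
      have := hα i hi
      simp at this
      omega
    clear he hα
    have : ∀ e : ℕ, (∀ i, n ≤ i → (Finsupp.single j e + α) i = 0) ∧
        D (mon p K (Finsupp.single j e + α)) ∈ wtSpan p K lam n
        (wt lam (Finsupp.single j e + α) - d) (wt lam (Finsupp.single j e + α) - c) := by
      intro e
      induction e with
      | zero => simpa using ⟨hα', ih hα'⟩
      | succ e he =>
        rw [add_comm e, Finsupp.single_add, add_assoc]
        refine ⟨fun i hi => ?_, key _ he.1 he.2 j hjn⟩
        rw [Finsupp.add_apply, he.1 i hi, Finsupp.single_eq_of_ne (by omega)]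
    exact (this e).2

lemma LowersBy.apply_mem (hm : 1 ≤ m) (h : LowersBy lam m D c d) {n : ℕ} {a b : ℝ}
    {f : TruncPoly p K} (hf : f ∈ wtSpan p K lam n a b) :
    D f ∈ wtSpan p K lam n (a - d) (b - c) := by
  induction hf using Submodule.span_induction with
  | mem x hx =>
    obtain ⟨α, ⟨hα, ha, hb⟩, rfl⟩ := hx
    exact wtSpan_mono le_rfl (by linarith) (by linarith) (h.apply_mon hm n α hα)
  | zero => rw [map_zero]; exact zero_mem _
  | add x y _ _ hx hy => rw [map_add]; exact add_mem hx hy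
  | smul a x _ hx => rw [Derivation.map_smul]; exact Submodule.smul_mem _ a hx

lemma LowersBy.pow_apply_mem (hm : 1 ≤ m) (h : LowersBy lam m D c d) {n : ℕ} {a b : ℝ}
    {f : TruncPoly p K} (hf : f ∈ wtSpan p K lam n a b) (j : ℕ) :
    ((D : TruncPoly p K →ₗ[K] TruncPoly p K) ^ j) f ∈ wtSpan p K lam n (a - j * d) (b - j * c) := by
  induction j with
  | zero => simpa using hf
  | succ j ih =>
    rw [pow_succ', Module.End.mul_apply]
    refine wtSpan_mono le_rfl ?_ ?_ (h.apply_mem hm ih) <;> push_cast <;> linarith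

lemma LowersBy.lie {c' d' : ℝ} (hm : 1 ≤ m) (hD : LowersBy lam m D c d)
    (hE : LowersBy lam m E c' d') : LowersBy lam m ⁅D, E⁆ (c + c') (d + d') := by
  intro i
  rw [Derivation.commutator_apply]
  exact sub_mem (wtSpan_mono le_rfl (by linarith) (by linarith) (hD.apply_mem hm (hE i)))
    (wtSpan_mono le_rfl (by linarith) (by linarith) (hE.apply_mem hm (hD i)))

lemma wtSpan_eq_bot (hlam : 0 ≤ lam) {n : ℕ} {a b : ℝ} (h : b < max a 0) :
    wtSpan p K lam n a b = ⊥ := by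
  have : {α : ℕ →₀ ℕ | (∀ i, n ≤ i → α i = 0) ∧ a ≤ wt lam α ∧ wt lam α ≤ b} = ∅ := by
    refine Set.eq_empty_of_forall_notMem ?_
    rintro α ⟨_, h1, h2⟩
    exact absurd (max_le h1 (wt_nonneg hlam α)) (by linarith)
  rw [wtSpan, this, Set.image_empty, Submodule.span_empty]

lemma exists_algebraMap_of_mem_wtSpan_zero {a b : ℝ} {f : TruncPoly p K}
    (hf : f ∈ wtSpan p K lam 0 a b) : ∃ c, f = algebraMap K _ c := by
  induction hf using Submodule.span_induction with
  | mem x hx =>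
    obtain ⟨α, ⟨hα, _⟩, rfl⟩ := hx
    obtain rfl : α = 0 := Finsupp.ext fun i => hα i (Nat.zero_le i)
    exact ⟨1, by rw [mon_zero, map_one]⟩
  | zero => exact ⟨0, by simp⟩
  | add x y _ _ hx hy =>
    obtain ⟨u, rfl⟩ := hx
    obtain ⟨v, rfl⟩ := hy
    exact ⟨u + v, by simp⟩
  | smul a x _ hx =>
    obtain ⟨u, rfl⟩ := hx
    exact ⟨a * u, by rw [map_mul]; exact Algebra.smul_def a (algebraMap K (TruncPoly p K) u)⟩

lemma wt_mapDomain_succ (α : ℕ →₀ ℕ) : wt lam (α.mapDomain Nat.succ) = lam * wt lam α := by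
  rw [wt, Finsupp.weight_apply, Finsupp.weight_apply,
    Finsupp.sum_mapDomain_index (by simp) (by intros; rw [add_smul]), Finsupp.mul_sum]
  refine Finsupp.sum_congr fun i _ => ?_
  simp only [nsmul_eq_mul, pow_succ]
  ring

lemma shift_mon (α : ℕ →₀ ℕ) : shift (mon p K α) = mon p K (α.mapDomain Nat.succ) := by
  induction α using Finsupp.induction with
  | zero => simp [mon_zero]
  | single_add j e α _ _ ih =>
    rw [mon_add, map_mul, ih, Finsupp.mapDomain_add, mon_add, Finsupp.mapDomain_single, mon_single,
      mon_single, map_pow, shift_var]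

lemma unshift_shift [Fact p.Prime] (f : TruncPoly p K) : unshift (shift f) = f := by
  have : (unshift.comp shift : TruncPoly p K →ₐ[K] TruncPoly p K) = AlgHom.id K _ :=
    algHom_ext fun i => by simp
  exact congr($this f)

lemma unshift_mem_wtSpan [Fact p.Prime] (hlam : 0 < lam) {n : ℕ} {a b : ℝ} {f : TruncPoly p K}
    (hf : f ∈ wtSpan p K lam n a b) :
    unshift f ∈ wtSpan p K lam (n - 1) (a / lam) (b / lam) := by
  induction hf using Submodule.span_induction with
  | mem x hx =>
    obtain ⟨α, ⟨hα, ha, hb⟩, rfl⟩ := hx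
    by_cases h0 : α 0 = 0
    · obtain ⟨β, rfl⟩ : ∃ β : ℕ →₀ ℕ, β.mapDomain Nat.succ = α := by
        refine ⟨α.comapDomain Nat.succ Nat.succ_injective.injOn,
          Finsupp.mapDomain_comapDomain _ Nat.succ_injective _ ?_⟩
        intro i hi
        obtain _ | i := i
        · simp [h0] at hi
        · exact ⟨i, rfl⟩
      rw [← shift_mon, unshift_shift]
      rw [wt_mapDomain_succ] at ha hb
      refine mon_mem_wtSpan (fun i hi => ?_) ?_ ?_
      · rw [← Finsupp.mapDomain_apply Nat.succ_injective β i]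
        exact hα _ (by omega)
      · rwa [div_le_iff₀' hlam]
      · rwa [le_div_iff₀' hlam]
    -- A monomial containing `x₀` is sent to zero, so its weight is irrelevant.
    · have : α = Finsupp.single 0 1 + (α - Finsupp.single 0 1) := by
        ext j
        obtain _ | j := j
        · simp; omega
        · simp
      rw [this, mon_add, mon_single, pow_one, map_mul, unshift_var_zero, zero_mul]
      exact zero_mem _
  | zero => rw [map_zero]; exact zero_mem _
  | add x y _ _ hx hy => rw [map_add]; exact add_mem hx hy
  | smul a x _ hx => rw [map_smul]; exact Submodule.smul_mem _ a hx

/-! ### Reduction modulo the first variable -/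

section Unshift

variable [Fact p.Prime] [CharP K p]

/-- The derivation obtained from `D` by setting `x₀ = 0` and renumbering the variables. -/
def unshiftDer (D : Derivation K (TruncPoly p K) (TruncPoly p K)) :
    Derivation K (TruncPoly p K) (TruncPoly p K) :=
  der fun i => unshift (D (var p K (i + 1)))

lemma LowersBy.unshiftDer (hlam : 0 < lam) (h : LowersBy lam m D c d) :
    LowersBy lam m (unshiftDer D) (c / lam) (d / lam) := by
  intro i
  have hi := unshift_mem_wtSpan hlam (h (i + 1))
  rw [TruncPoly.unshiftDer, der_var]
  refine wtSpan_mono (by omega) (le_of_eq ?_) (le_of_eq ?_) hi <;>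
    rw [sub_div, pow_succ, mul_div_cancel_right₀ _ hlam.ne']

lemma unshift_der (hD : D (var p K 0) = 0) (f : TruncPoly p K) :
    unshift (D f) = unshiftDer D (unshift f) := by
  induction f using induction with
  | algebraMap c => simp
  | var i => cases i <;> simp [hD, unshiftDer]
  | add f g hf hg => simp only [map_add, hf, hg]
  | mul f g hf hg => simp only [Derivation.leibniz, smul_eq_mul, map_add, map_mul, hf, hg]

/-- Nilpotency modulo `x₀` means that `D ^ n` has image in the multiples of `x₀`. Since `D` commutes
with multiplication by `x₀`, each further `n` steps gain another factor `x₀`, and `x₀ ^ p = 0`. -/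
lemma isNilpotent_of_unshiftDer (hD : D (var p K 0) = 0)
    (h : IsNilpotent (unshiftDer D : TruncPoly p K →ₗ[K] TruncPoly p K)) :
    IsNilpotent (D : TruncPoly p K →ₗ[K] TruncPoly p K) := by
  obtain ⟨n, hn⟩ := h
  have h1 : ∀ (j : ℕ) (f : TruncPoly p K), unshift (((D : TruncPoly p K →ₗ[K] TruncPoly p K) ^ j) f) =
      ((unshiftDer D : TruncPoly p K →ₗ[K] TruncPoly p K) ^ j) (unshift f) := by
    intro j f
    induction j with
    | zero => simp
    | succ j ih =>
      rw [pow_succ', pow_succ', Module.End.mul_apply, Module.End.mul_apply, ← ih]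
      exact unshift_der hD _
  have h2 : ∀ (j l : ℕ) (f : TruncPoly p K), ((D : TruncPoly p K →ₗ[K] TruncPoly p K) ^ j) (var p K 0 ^ l * f) =
      var p K 0 ^ l * ((D : TruncPoly p K →ₗ[K] TruncPoly p K) ^ j) f := by
    intro j l f
    induction j with
    | zero => simp
    | succ j ih =>
      rw [pow_succ', Module.End.mul_apply, Module.End.mul_apply, ih]
      simp [Derivation.leibniz_pow, hD]
  have h3 : ∀ (j : ℕ) (f : TruncPoly p K),
      var p K 0 ^ j ∣ ((D : TruncPoly p K →ₗ[K] TruncPoly p K) ^ (n * j)) f := by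
    intro j f
    induction j with
    | zero => simp
    | succ j ih =>
      obtain ⟨g, hg⟩ := ih
      rw [pow_succ, mul_add, mul_one, add_comm (n * j), pow_add, Module.End.mul_apply, hg, h2]
      refine mul_dvd_mul_left _ (var_zero_dvd_of_unshift_eq_zero ?_)
      rw [h1, hn, LinearMap.zero_apply]
  refine ⟨n * p, LinearMap.ext fun f => ?_⟩
  simpa [var_pow] using h3 p f

end Unshift

/-! ### Weights attached to the root of `λ^(m-1) (λ-1) = p-1` -/

section Root

variable (hm : 2 ≤ m) (hlam1 : 1 < lam) (hlam : lam ^ (m - 1) * (lam - 1) = p - 1)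

-- The extreme case has all exponents equal to `p - 1`; the equation for `lam` then makes the
-- geometric sum telescope to `lam ^ (n + (m - 1)) - lam ^ (m - 1)`.
include hlam hlam1 in
lemma wt_add_le {n : ℕ} {α : ℕ →₀ ℕ} (h : ∀ i, n ≤ i → α i = 0) (hp : ∀ i, α i + 1 ≤ p) :
    wt lam α + lam ^ (m - 1) ≤ lam ^ (n + (m - 1)) := by
  rw [wt_eq_sum h]
  have h1 : ∑ i ∈ Finset.range n, (α i : ℝ) * lam ^ i ≤
      ∑ i ∈ Finset.range n, ((p : ℝ) - 1) * lam ^ i := by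
    refine Finset.sum_le_sum fun i _ => ?_
    have h2 : (α i : ℝ) + 1 ≤ p := by exact_mod_cast hp i
    exact mul_le_mul_of_nonneg_right (by linarith) (by positivity)
  rw [← Finset.mul_sum, ← hlam, mul_assoc, mul_geom_sum] at h1
  rw [pow_add]
  linarith

-- Monomials with an exponent at least `p` vanish, and the others obey `wt_add_le`; an upper bound
-- on the weight is therefore free once it reaches that maximum.
include hlam hlam1 in
lemma wtSpan_le (n : ℕ) {a b b' : ℝ} (hb : lam ^ (n + (m - 1)) - lam ^ (m - 1) ≤ b') :
    wtSpan p K lam n a b ≤ wtSpan p K lam n a b' := by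
  rw [wtSpan, Submodule.span_le]
  rintro _ ⟨α, ⟨hα, h1, h2⟩, rfl⟩
  by_cases hp : ∀ i, α i + 1 ≤ p
  · exact mon_mem_wtSpan hα h1 (by linarith [wt_add_le hlam1 hlam hα hp])
  · push Not at hp
    obtain ⟨i, hi⟩ := hp
    rw [mon_eq_zero p K (by omega : p ≤ α i)]
    exact zero_mem _

-- The drop is at least `lam` at every variable except `x₀`. For `m ≤ i + 1` the maximal weight of
-- the coefficient leaves a drop of `lam ^ (m - 1)`; for smaller `i` the coefficient is constant and
-- the drop is `lam ^ i`.
include hm hlam hlam1 in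
lemma LowersBy.apply_var (h : LowersBy lam m D c d) {i : ℕ} (hi : i ≠ 0) :
    D (var p K i) ∈ wtSpan p K lam (i + 1 - m) (lam ^ i - d) (lam ^ i - lam) := by
  refine wtSpan_le hlam1 hlam _ ?_ (h i)
  rcases le_or_gt m (i + 1) with h | h
  · rw [show i + 1 - m + (m - 1) = i by omega]
    linarith [le_self_pow₀ hlam1.le (show m - 1 ≠ 0 by omega)]
  · rw [show i + 1 - m + (m - 1) = m - 1 by omega]
    linarith [le_self_pow₀ hlam1.le hi]

-- No hypothesis on `c` is needed: `D x₀` is a constant, so the drop there is `1`, and it is at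
-- least `lam` at the other variables. This resets the lower bound after brackets, powers and
-- renumbering.
include hm hlam hlam1 in
lemma LowersBy.one (h : LowersBy lam m D c d) : LowersBy lam m D 1 d := by
  intro i
  by_cases hi : i = 0
  · subst hi
    refine wtSpan_le hlam1 hlam _ ?_ (h 0)
    simp [show 0 + 1 - m = 0 by omega]
  · exact wtSpan_mono le_rfl le_rfl (by linarith) (h.apply_var hm hlam1 hlam hi)

include hlam1 in
lemma LowersBy.apply_var_zero (h : LowersBy lam m D c d) (hc : 1 < c) : D (var p K 0) = 0 := by
  have := h 0
  rwa [wtSpan_eq_bot (by linarith) (by simpa using Or.inr hc), Submodule.mem_bot] at this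

variable [Fact p.Prime] [CharP K p]

-- In `D ^ p xᵢ` with `i ≠ 0`, the first application drops the weight by at least `lam` and each of
-- the other `p - 1` by at least `1`. The excess `lam - 1` is what makes the ratio of the bounds
-- decrease.
include hm hlam hlam1 in
lemma LowersBy.derivationPow (h : LowersBy lam m D 1 d) :
    LowersBy lam m (derivationPow p D) (p + lam - 1) (p * d) := by
  obtain ⟨q, hq⟩ : ∃ q, p = q + 2 := ⟨p - 2, by have := (Fact.out : p.Prime).two_le; omega⟩
  intro i
  have hpow : SelfSimilar.derivationPow p D (var p K i) =
      ((D : TruncPoly p K →ₗ[K] TruncPoly p K) ^ (q + 1)) (D (var p K i)) := by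
    rw [derivationPow_apply, ← Derivation.coeFn_coe, ← Module.End.mul_apply, ← pow_succ]
    congr 2
  rw [hpow]
  by_cases hi : i = 0
  -- `D x₀` is a constant, which the second application of `D` kills; there is one because `p ≥ 2`.
  · subst hi
    have h0 := h 0
    rw [show 0 + 1 - m = 0 by omega] at h0
    obtain ⟨u, hu⟩ := exists_algebraMap_of_mem_wtSpan_zero h0
    rw [hu, pow_succ, Module.End.mul_apply, Derivation.coeFn_coe, Derivation.map_algebraMap,
      map_zero]
    exact zero_mem _
  · have hp : (p : ℝ) = q + 2 := by rw [hq]; push_cast; ring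
    refine wtSpan_mono le_rfl ?_ ?_
      (h.pow_apply_mem (by omega) (h.apply_var hm hlam1 hlam hi) (q + 1)) <;>
    rw [hp] <;> push_cast <;> linarith

-- Only the ratio of the bounds matters: while `1 < c`, passing to `unshiftDer` divides both by
-- `lam`, and once `c ≤ 1` the condition `d < B * c` gives `d < B`. The number `R` bounds how many
-- reductions this takes.
include hm hlam hlam1 in
lemma isNilpotent_of_lowersBy_of_forall {B : ℝ} (hB : 0 ≤ B)
    (ih : ∀ (d : ℝ) (D : Derivation K (TruncPoly p K) (TruncPoly p K)), d < B → LowersBy lam m D 1 d →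
      IsNilpotent (D : TruncPoly p K →ₗ[K] TruncPoly p K)) (R : ℕ) :
    ∀ (c d : ℝ) (D : Derivation K (TruncPoly p K) (TruncPoly p K)), c ≤ lam ^ R → d < B * c →
      LowersBy lam m D c d → IsNilpotent (D : TruncPoly p K →ₗ[K] TruncPoly p K) := by
  have base : ∀ (c d : ℝ) (D : Derivation K (TruncPoly p K) (TruncPoly p K)), c ≤ 1 → d < B * c →
      LowersBy lam m D c d → IsNilpotent (D : TruncPoly p K →ₗ[K] TruncPoly p K) :=
    fun c d D hc hd hD => ih d D (hd.trans_le (mul_le_of_le_one_right hB hc))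
      (hD.one hm hlam1 hlam)
  induction R with
  | zero => intro c d D hc; exact base c d D (by simpa using hc)
  | succ R ihR =>
    intro c d D hc hd hD
    rcases le_or_gt c 1 with h | h
    · exact base c d D h hd hD
    · refine isNilpotent_of_unshiftDer (hD.apply_var_zero hlam1 h)
        (ihR (c / lam) (d / lam) _ ?_ ?_ (hD.unshiftDer (by linarith)))
      · rwa [div_le_iff₀ (by linarith), ← pow_succ]
      · rw [← mul_div_assoc]
        exact div_lt_div_of_pos_right hd (by linarith)

include hm hlam hlam1 in
/-- A derivation that lowers weights by a bounded amount is nilpotent. -/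
theorem LowersBy.isNilpotent (h : LowersBy lam m D c d) :
    IsNilpotent (D : TruncPoly p K →ₗ[K] TruncPoly p K) := by
  have hp : (0 : ℝ) < p := by exact_mod_cast (Fact.out : p.Prime).pos
  have hq : 1 < ((p : ℝ) + lam - 1) / p := by rw [one_lt_div hp]; linarith
  -- The induction measures `d` in powers of the factor `(p + lam - 1) / p` gained by one `p`-th
  -- power.
  have key : ∀ (n : ℕ) (d : ℝ) (D : Derivation K (TruncPoly p K) (TruncPoly p K)),
      d < (((p : ℝ) + lam - 1) / p) ^ n → LowersBy lam m D 1 d →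
      IsNilpotent (D : TruncPoly p K →ₗ[K] TruncPoly p K) := by
    intro n
    induction n with
    | zero =>
      intro d D hd hD
      -- With `d < 1` the interval `[lam ^ i - d, lam ^ i - 1]` of allowed weights is empty.
      have : D = 0 := derivation_ext fun i => by
        have := hD i
        rw [pow_zero] at hd
        rwa [wtSpan_eq_bot (by linarith) (lt_max_of_lt_left (by linarith)),
          Submodule.mem_bot] at this
      rw [this]
      exact ⟨1, by simp⟩
    | succ n ih =>
      intro d D hd hD
      obtain ⟨R, hR⟩ := pow_unbounded_of_one_lt ((p : ℝ) + lam - 1) hlam1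
      have := isNilpotent_of_lowersBy_of_forall hm hlam1 hlam (by positivity) ih R _ _ _ hR.le ?_
        (hD.derivationPow hm hlam1 hlam)
      · rw [coe_derivationPow] at this
        exact this.of_pow
      · rw [pow_succ, ← mul_div_assoc, lt_div_iff₀ hp] at hd
        linarith
  obtain ⟨n, hn⟩ := pow_unbounded_of_one_lt d hq
  exact key n d D hn (h.one hm hlam1 hlam)

end Root

end Weights

end TruncPoly

/-! ### Embedding the tensor algebra into truncated polynomials -/

section Realization

open Polynomial TruncPoly

variable (p : ℕ) (k : Type*) [Field k]

/-- The homomorphism `x ↦ x₀`. -/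
def Alphabet.toTrunc : Alphabet p k →ₐ[k] TruncPoly p k[X] :=
  Ideal.Quotient.liftₐ _ (Polynomial.aeval (var p k[X] 0)) <| by
    intro a ha
    obtain ⟨c, rfl⟩ := Ideal.mem_span_singleton.1 ha
    simp [var_pow]

lemma Alphabet.toTrunc_mk (f : k[X]) :
    Alphabet.toTrunc p k (Ideal.Quotient.mk _ f) = Polynomial.aeval (var p k[X] 0) f := rfl

/-- The variable that records the degree of a tensor. -/
def degreeVar : TruncPoly p k[X] := algebraMap k[X] _ X

/-- The linear map `T(X) → k[t, x₀, x₁, …]` sending `y₀ ⊗ ⋯ ⊗ yₙ₋₁` to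
`t ^ n * y₀(x₀) * ⋯ * yₙ₋₁(xₙ₋₁)`. -/
def realize : TensorAlgebra k (Alphabet p k) →ₗ[k] TruncPoly p k[X] :=
  LinearMap.applyₗ (1 : TruncPoly p k[X]) ∘ₗ (TensorAlgebra.lift k
    (LinearMap.mulRight k ((TruncPoly.shift : TruncPoly p k[X] →ₐ[k[X]] TruncPoly p k[X]).toLinearMap.restrictScalars k
        : Module.End k (TruncPoly p k[X])) ∘ₗ
      LinearMap.mul k (TruncPoly p k[X]) ∘ₗ LinearMap.mulLeft k (degreeVar p k) ∘ₗ
      (Alphabet.toTrunc p k).toLinearMap)).toLinearMap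

lemma realize_one : realize p k 1 = 1 := by
  simp [realize]

lemma realize_ι_mul (y : Alphabet p k) (w : TensorAlgebra k (Alphabet p k)) :
    realize p k (TensorAlgebra.ι k y * w) =
      degreeVar p k * Alphabet.toTrunc p k y * TruncPoly.shift (realize p k w) := by
  simp [realize]

/-! ### Injectivity of the realization -/

/-- The basis of `k[x]/(x ^ p)` consisting of the powers of `x`. -/
def Alphabet.powerBasis : PowerBasis k (Alphabet p k) :=
  AdjoinRoot.powerBasis' (monic_X_pow (R := k) p)

lemma Alphabet.powerBasis_dim : (Alphabet.powerBasis p k).dim = p :=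
  natDegree_X_pow p

lemma Alphabet.powerBasis_basis (i : Fin (Alphabet.powerBasis p k).dim) :
    (Alphabet.powerBasis p k).basis i = Ideal.Quotient.mk _ (X ^ (i : ℕ)) := by
  rw [PowerBasis.basis_eq_pow, map_pow]
  rfl

lemma tensorAlgebra_basis_apply {R M κ : Type*} [CommRing R] [AddCommGroup M] [Module R M]
    (b : Module.Basis κ R M) (l : FreeMonoid κ) :
    b.tensorAlgebra l = FreeMonoid.lift (fun i => TensorAlgebra.ι R (b i)) l := by
  have : ((TensorAlgebra.equivFreeAlgebra b).symm : FreeAlgebra R κ →* TensorAlgebra R M).comp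
      (FreeMonoid.lift (FreeAlgebra.ι R)) = FreeMonoid.lift (fun i => TensorAlgebra.ι R (b i)) := by
    ext i
    simp
  rw [← this]
  simp [Module.Basis.tensorAlgebra, FreeAlgebra.basisFreeMonoid,
    FreeAlgebra.equivMonoidAlgebraFreeMonoid]

/-- The exponents of a word. -/
def wordExponents {n : ℕ} : List (Fin n) → ℕ →₀ ℕ
  | [] => 0
  | i :: l => Finsupp.single 0 (i : ℕ) + (wordExponents l).mapDomain Nat.succ

lemma wordExponents_cons_zero {n : ℕ} (i : Fin n) (l : List (Fin n)) :
    wordExponents (i :: l) 0 = i := by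
  rw [wordExponents, Finsupp.add_apply, Finsupp.single_eq_same, Finsupp.mapDomain_of_notMem_range]
  · simp
  · simp

lemma wordExponents_cons_succ {n : ℕ} (i : Fin n) (l : List (Fin n)) (j : ℕ) :
    wordExponents (i :: l) (j + 1) = wordExponents l j := by
  rw [wordExponents, Finsupp.add_apply, Finsupp.single_eq_of_ne (by omega),
    ← Nat.succ_eq_add_one, Finsupp.mapDomain_apply Nat.succ_injective, zero_add]

lemma wordExponents_lt {n : ℕ} (hn : 0 < n) (l : List (Fin n)) (j : ℕ) :
    wordExponents l j < n := by
  induction l generalizing j with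
  | nil => exact hn
  | cons i l ih =>
    cases j with
    | zero => rw [wordExponents_cons_zero]; exact i.2
    | succ j => rw [wordExponents_cons_succ]; exact ih j

/-- Trailing letters of exponent `0` leave no trace in the exponents, so the length has to be known
separately; the variable `degreeVar` supplies it. -/
lemma wordExponents_injective {n : ℕ} {l l' : List (Fin n)} (h : l.length = l'.length)
    (h' : wordExponents l = wordExponents l') : l = l' := by
  induction l generalizing l' with
  | nil => simpa using h.symm
  | cons i l ih =>
    cases l' with
    | nil => simp at h
    | cons i' l' =>
      have h0 := DFunLike.congr_fun h' 0
      rw [wordExponents_cons_zero, wordExponents_cons_zero] at h0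
      rw [Fin.ext h0, ih (by simpa using h) (Finsupp.ext fun j => by
        simpa only [wordExponents_cons_succ] using DFunLike.congr_fun h' (j + 1))]

/-- The ideal is monomial, so each monomial in the support of one of its elements is divisible by
some `xᵢ ^ p`. -/
lemma coeff_eq_zero_of_mk_eq_zero {K : Type*} [CommRing K] {f : MvPolynomial ℕ K}
    (hf : (Ideal.Quotient.mk _ f : TruncPoly p K) = 0) {α : ℕ →₀ ℕ} (hα : ∀ i, α i < p) :
    f.coeff α = 0 := by
  rw [Ideal.Quotient.eq_zero_iff_mem] at hf
  have : Set.range (fun i : ℕ => (MvPolynomial.X i : MvPolynomial ℕ K) ^ p) =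
      (fun s => MvPolynomial.monomial s (1 : K)) '' Set.range fun i : ℕ => Finsupp.single i p := by
    rw [← Set.range_comp]
    congr 1
    ext1 i
    exact MvPolynomial.X_pow_eq_monomial
  rw [this, MvPolynomial.mem_ideal_span_monomial_image] at hf
  by_contra h
  obtain ⟨_, ⟨i, rfl⟩, hi⟩ := hf α (MvPolynomial.mem_support_iff.2 h)
  have := hi i
  rw [Finsupp.single_eq_same] at this
  exact absurd (hα i) (by omega)

/-- Words in the powers of `x` form a basis of `T(X)`, and a word is recovered from its length and
its exponents, all below `p`. The map `φ` lifts `realize` to genuine polynomials, where coefficients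
can be read off. -/
lemma realize_injective [Fact p.Prime] : Function.Injective (realize p k) := by
  set pb := Alphabet.powerBasis p k
  have hdim : pb.dim = p := Alphabet.powerBasis_dim p k
  set B := pb.basis.tensorAlgebra
  let φ : TensorAlgebra k (Alphabet p k) →ₗ[k] MvPolynomial ℕ k[X] :=
    B.constr k fun l => MvPolynomial.monomial (wordExponents (FreeMonoid.toList l))
      (X ^ (FreeMonoid.toList l).length)
  have hword : ∀ l : FreeMonoid (Fin pb.dim), realize p k (B l) =
      degreeVar p k ^ (FreeMonoid.toList l).length *
        mon p k[X] (wordExponents (FreeMonoid.toList l)) := by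
    intro l
    rw [tensorAlgebra_basis_apply]
    induction l using FreeMonoid.inductionOn' with
    | one => simp [realize_one, wordExponents, mon_zero]
    | of_mul i l ih =>
      rw [map_mul, FreeMonoid.lift_eval_of, realize_ι_mul, ih, Alphabet.powerBasis_basis,
        Alphabet.toTrunc_mk, map_mul, TruncPoly.shift_mon, FreeMonoid.toList_of_mul, wordExponents,
        mon_add, mon_single, map_pow, List.length_cons, pow_succ]
      have : TruncPoly.shift (degreeVar p k) = degreeVar p k := AlgHom.commutes _ _
      rw [map_pow, this, aeval_X]
      ring
  have hφ : ∀ z, (Ideal.Quotient.mk _ (φ z) : TruncPoly p k[X]) = realize p k z := by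
    have : (Ideal.Quotient.mkₐ k (Ideal.span
        (Set.range fun i : ℕ => (MvPolynomial.X i : MvPolynomial ℕ k[X]) ^ p))).toLinearMap ∘ₗ φ =
        realize p k := by
      refine B.ext fun l => ?_
      rw [hword, LinearMap.comp_apply, Module.Basis.constr_basis]
      have : (MvPolynomial.monomial (wordExponents (FreeMonoid.toList l)))
          ((X : k[X]) ^ (FreeMonoid.toList l).length) =
          algebraMap k[X] _ X ^ (FreeMonoid.toList l).length *
            MvPolynomial.monomial (wordExponents (FreeMonoid.toList l)) 1 := by
        rw [← map_pow, MvPolynomial.algebraMap_eq, MvPolynomial.C_mul_monomial, mul_one]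
      rw [this]
      rfl
    exact fun z => congr($this z)
  have hcoeff : ∀ (z) (l : FreeMonoid (Fin pb.dim)),
      ((φ z).coeff (wordExponents (FreeMonoid.toList l))).coeff (FreeMonoid.toList l).length =
        B.repr z l := by
    intro z l
    have : (Polynomial.lcoeff k (FreeMonoid.toList l).length) ∘ₗ
        ((MvPolynomial.lcoeff k[X] (wordExponents (FreeMonoid.toList l))).restrictScalars k) ∘ₗ φ =
        B.coord l := by
      refine B.ext fun l' => ?_
      simp only [LinearMap.comp_apply, φ, Module.Basis.constr_basis, Module.Basis.coord_apply,
        Module.Basis.repr_self, LinearMap.restrictScalars_apply, MvPolynomial.lcoeff_apply,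
        Polynomial.lcoeff_apply, MvPolynomial.coeff_monomial]
      by_cases h : l' = l
      · subst h; simp
      · rw [Finsupp.single_eq_of_ne' h]
        split_ifs with h1
        · rw [Polynomial.coeff_X_pow, if_neg]
          exact fun h2 => h (FreeMonoid.toList.injective (wordExponents_injective h2.symm h1))
        · simp
    exact congr($this z)
  rw [injective_iff_map_eq_zero]
  intro z hz
  rw [← hφ] at hz
  refine B.repr.map_eq_zero_iff.1 (Finsupp.ext fun l => ?_)
  rw [← hcoeff, coeff_eq_zero_of_mk_eq_zero p hz, Polynomial.coeff_zero, Finsupp.zero_apply]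
  intro i
  refine (wordExponents_lt ?_ _ i).trans_le hdim.le
  rw [hdim]
  exact (Fact.out : p.Prime).pos

end Realization

section Operators

open Polynomial TruncPoly

variable (p : ℕ) (k : Type*) [Field k]

/-! ### The partial derivatives and the pivot element as derivations -/

section Derivations

variable {p} {K : Type*} [CommRing K] [CharP K p] {lam : ℝ} {m : ℕ}

variable (p K) in
/-- The partial derivative `∂ / ∂ xₙ`. -/
def partialDer (n : ℕ) : Derivation K (TruncPoly p K) (TruncPoly p K) := der (Pi.single n 1)

variable (p K m) in
/-- The derivation `∑ (x₀ ⋯ xⱼ₋₁) ^ (p - 1) ∂ / ∂ x_{j + m - 1}`. -/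
def pivotDer : Derivation K (TruncPoly p K) (TruncPoly p K) :=
  der fun i => if i + 1 < m then 0 else ∏ l ∈ Finset.range (i + 1 - m), var p K l ^ (p - 1)

lemma partialDer_var_self (n : ℕ) : partialDer p K n (var p K n) = 1 := by
  simp [partialDer]

lemma partialDer_var_of_ne {n i : ℕ} (h : i ≠ n) : partialDer p K n (var p K i) = 0 := by
  simp [partialDer, h]

lemma partialDer_zero_shift (f : TruncPoly p K) : partialDer p K 0 (shift f) = 0 := by
  induction f using TruncPoly.induction with
  | algebraMap c => simp
  | var i => rw [shift_var, partialDer_var_of_ne (by omega)]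
  | add f g hf hg => rw [map_add, map_add, hf, hg, add_zero]
  | mul f g hf hg => rw [map_mul, Derivation.leibniz, hf, hg, smul_zero, smul_zero, add_zero]

lemma partialDer_succ_shift (n : ℕ) (f : TruncPoly p K) :
    partialDer p K (n + 1) (shift f) = shift (partialDer p K n f) := by
  induction f using TruncPoly.induction with
  | algebraMap c => simp
  | var i =>
    rw [shift_var]
    by_cases h : i = n
    · rw [h, partialDer_var_self, partialDer_var_self, map_one]
    · rw [partialDer_var_of_ne h, partialDer_var_of_ne (by omega), map_zero]
  | add f g hf hg => simp only [map_add, hf, hg]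
  | mul f g hf hg => simp only [map_mul, map_add, Derivation.leibniz, hf, hg, smul_eq_mul]

lemma pivotDer_var_zero (hm : 2 ≤ m) : pivotDer p K m (var p K 0) = 0 := by
  rw [pivotDer, der_var, if_pos (by omega)]

/-- The polynomial form of `v ↦ 1 ⊗ d_{m-1} + x^(p-1) ⊗ v`; the index is `m - 2` because `d_{n+1}`
acts as `∂/∂xₙ`. -/
lemma pivotDer_shift (hm : 2 ≤ m) (f : TruncPoly p K) :
    pivotDer p K m (shift f) =
      shift (partialDer p K (m - 2) f) + var p K 0 ^ (p - 1) * shift (pivotDer p K m f) := by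
  induction f using TruncPoly.induction with
  | algebraMap c => simp
  | var i =>
    rw [shift_var]
    simp only [pivotDer, der_var]
    rcases lt_trichotomy (i + 2) m with h | h | h
    · rw [if_pos (by omega), if_pos (by omega), partialDer_var_of_ne (by omega)]
      simp
    · rw [if_neg (by omega), if_pos (by omega), show i = m - 2 by omega, partialDer_var_self,
        show m - 2 + 1 + 1 - m = 0 by omega]
      simp
    · rw [if_neg (by omega), if_neg (by omega), partialDer_var_of_ne (by omega),
        show i + 1 + 1 - m = (i + 1 - m) + 1 by omega, Finset.prod_range_succ']
      simp [mul_comm]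
  | add f g hf hg => simp only [map_add, hf, hg]; ring
  | mul f g hf hg => simp only [map_mul, map_add, Derivation.leibniz, hf, hg, smul_eq_mul]; ring

lemma lowersBy_partialDer (hlam : 1 ≤ lam) (n : ℕ) :
    LowersBy lam m (partialDer p K n) 1 (lam ^ n) := by
  intro i
  by_cases h : i = n
  · rw [h, partialDer_var_self, ← mon_zero]
    exact mon_mem_wtSpan (by simp) (by simp) (by simpa using one_le_pow₀ hlam)
  · rw [partialDer_var_of_ne h]
    exact zero_mem _

/-- Every term lowers weights by exactly `lam ^ (m - 1)`. This homogeneity is the reason for the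
equation imposed on `lam`. -/
lemma lowersBy_pivotDer [Fact p.Prime] (hm : 2 ≤ m) (hlam1 : 1 ≤ lam)
    (hlam : lam ^ (m - 1) * (lam - 1) = p - 1) :
    LowersBy lam m (pivotDer p K m) 1 (lam ^ (m - 1)) := by
  intro i
  rw [pivotDer, der_var]
  split_ifs with h
  · exact zero_mem _
  · have hmon : ∏ l ∈ Finset.range (i + 1 - m), var p K l ^ (p - 1) =
        mon p K (∑ l ∈ Finset.range (i + 1 - m), Finsupp.single l (p - 1)) := by
      induction i + 1 - m with
      | zero => simp [mon_zero]
      | succ n ih => rw [Finset.prod_range_succ, Finset.sum_range_succ, mon_add, ih, mon_single]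
    have hwt : wt lam (∑ l ∈ Finset.range (i + 1 - m), Finsupp.single l (p - 1)) =
        lam ^ i - lam ^ (m - 1) := by
      have hp : ((p - 1 : ℕ) : ℝ) = p - 1 := by
        rw [Nat.cast_sub (Fact.out : p.Prime).one_le, Nat.cast_one]
      simp only [map_sum, wt_single, hp]
      rw [← Finset.mul_sum, ← hlam, mul_assoc, mul_geom_sum, mul_sub, mul_one, ← pow_add]
      congr 2
      omega
    rw [hmon]
    refine mon_mem_wtSpan (fun j hj => ?_) hwt.ge ?_
    · rw [Finsupp.finsetSum_apply]
      exact Finset.sum_eq_zero fun l hl => Finsupp.single_eq_of_ne (by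
        rw [Finset.mem_range] at hl; omega)
    · rw [hwt]
      linarith [one_le_pow₀ hlam1 (n := m - 1)]

end Derivations

/-! ### Operators on the tensor algebra induced by derivations -/

section Realizes

variable {p k} [CharP k p]

/-- The derivation `D` extends the operator `A` on the tensor algebra. -/
def Realizes (D : Derivation k[X] (TruncPoly p k[X]) (TruncPoly p k[X]))
    (A : Module.End k (TensorAlgebra k (Alphabet p k))) : Prop :=
  ∀ w, realize p k (A w) = D (realize p k w)

variable {D E : Derivation k[X] (TruncPoly p k[X]) (TruncPoly p k[X])}
  {A B : Module.End k (TensorAlgebra k (Alphabet p k))}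

/-- The chain rule for a polynomial in `x₀`. -/
lemma derivation_toTrunc (y : Alphabet p k) :
    D (Alphabet.toTrunc p k y) = Alphabet.toTrunc p k (Alphabet.ddx p k y) * D (var p k[X] 0) := by
  obtain ⟨f, rfl⟩ := Ideal.Quotient.mk_surjective y
  rw [Alphabet.ddx_mk, Alphabet.toTrunc_mk, Alphabet.toTrunc_mk]
  exact (D.restrictScalars k).map_aeval f _

lemma derivation_realize_ι_mul (y : Alphabet p k) (w : TensorAlgebra k (Alphabet p k)) :
    D (realize p k (TensorAlgebra.ι k y * w)) =
      degreeVar p k * Alphabet.toTrunc p k y * D (shift (realize p k w)) +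
      degreeVar p k * Alphabet.toTrunc p k (Alphabet.ddx p k y) * shift (realize p k w) *
        D (var p k[X] 0) := by
  have : D (degreeVar p k) = 0 := D.map_algebraMap _
  rw [realize_ι_mul, Derivation.leibniz, Derivation.leibniz, this, derivation_toTrunc]
  simp only [smul_eq_mul]
  ring

omit [CharP k p] in
lemma realizes_of_ι_mul (h1 : A 1 = 0)
    (h : ∀ y w, realize p k (A w) = D (realize p k w) →
      realize p k (A (TensorAlgebra.ι k y * w)) = D (realize p k (TensorAlgebra.ι k y * w))) :
    Realizes D A := by
  intro w
  induction w using tensor_induction with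
  | one => rw [h1, realize_one, map_zero, Derivation.map_one_eq_zero]
  | smul c w hw =>
    rw [map_smul, map_smul, map_smul, hw]
    exact ((D.restrictScalars k).map_smul c _).symm
  | add v w hv hw => rw [map_add, map_add, map_add, map_add, hv, hw]
  | ι_mul y w hw => exact h y w hw

omit [CharP k p] in
lemma Realizes.pow (h : Realizes D A) (n : ℕ) (w : TensorAlgebra k (Alphabet p k)) :
    realize p k ((A ^ n) w) =
      ((D : TruncPoly p k[X] →ₗ[k[X]] TruncPoly p k[X]) ^ n) (realize p k w) := by
  induction n with
  | zero => simp
  | succ n ih =>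
    rw [pow_succ', pow_succ', Module.End.mul_apply, Module.End.mul_apply, h, ih]
    rfl

omit [CharP k p] in
lemma Realizes.isNilpotent [Fact p.Prime] (h : Realizes D A)
    (hD : IsNilpotent (D : TruncPoly p k[X] →ₗ[k[X]] TruncPoly p k[X])) : IsNilpotent A := by
  obtain ⟨n, hn⟩ := hD
  refine ⟨n, LinearMap.ext fun w => realize_injective p k ?_⟩
  rw [h.pow, hn, LinearMap.zero_apply, LinearMap.zero_apply, map_zero]

variable (p k) in
/-- The operators induced by derivations that lower weights by a bounded amount. -/
def boundedOperators [Fact p.Prime] {m : ℕ} (hm : 2 ≤ m) {lam : ℝ} (hlam1 : 1 < lam)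
    (hlam : lam ^ (m - 1) * (lam - 1) = p - 1) :
    LieSubalgebra k (Module.End k (TensorAlgebra k (Alphabet p k))) where
  carrier := {A | ∃ D d, LowersBy lam m D 1 d ∧ Realizes D A}
  zero_mem' := ⟨0, 0, fun _ => zero_mem _, fun w => by simp⟩
  add_mem' := by
    rintro A B ⟨D, d, hD, hA⟩ ⟨E, e, hE, hB⟩
    refine ⟨D + E, max d e, (hD.mono le_rfl (le_max_left _ _)).add
      (hE.mono le_rfl (le_max_right _ _)), fun w => ?_⟩
    rw [LinearMap.add_apply, map_add, hA, hB, Derivation.add_apply]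
  smul_mem' := by
    rintro c A ⟨D, d, hD, hA⟩
    -- Scalars from `k` enter as constant polynomials in `t`, because `D` is taken over `k[t]`.
    refine ⟨C c • D, d, hD.smul _, fun w => ?_⟩
    rw [LinearMap.smul_apply, map_smul, hA, Derivation.smul_apply]
    exact (algebraMap_smul k[X] c (D (realize p k w))).symm
  lie_mem' := by
    rintro A B ⟨D, d, hD, hA⟩ ⟨E, e, hE, hB⟩
    refine ⟨⁅D, E⁆, d + e, (hD.lie (by omega) hE).one hm hlam1 hlam, fun w => ?_⟩
    rw [LieRing.of_associative_ring_bracket, LinearMap.sub_apply, Module.End.mul_apply,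
      Module.End.mul_apply, map_sub, hA, hB, hB, hA, Derivation.commutator_apply]

lemma pow_mem_boundedOperators [Fact p.Prime] {m : ℕ} (hm : 2 ≤ m) {lam : ℝ} (hlam1 : 1 < lam)
    (hlam : lam ^ (m - 1) * (lam - 1) = p - 1) (hA : A ∈ boundedOperators p k hm hlam1 hlam) :
    A ^ p ∈ boundedOperators p k hm hlam1 hlam := by
  obtain ⟨D, d, hD, hA⟩ := hA
  exact ⟨derivationPow p D, p * d, (hD.derivationPow hm hlam1 hlam).one hm hlam1 hlam, hA.pow p⟩

lemma isNilpotent_of_mem_boundedOperators [Fact p.Prime] {m : ℕ} (hm : 2 ≤ m) {lam : ℝ}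
    (hlam1 : 1 < lam) (hlam : lam ^ (m - 1) * (lam - 1) = p - 1)
    (hA : A ∈ boundedOperators p k hm hlam1 hlam) : IsNilpotent A := by
  obtain ⟨D, d, hD, hA⟩ := hA
  exact hA.isNilpotent (hD.isNilpotent hm hlam1 hlam)

end Realizes

/-! ### The generators -/

section Generators

variable {m : ℕ} (hm : 2 ≤ m) [CharP k p]

/-- The operator through which an element of the free Lie algebra acts on the tensor algebra. -/
abbrev pszAction : FreeLieAlgebra k (Gen m) →ₗ⁅k⁆ Module.End k (TensorAlgebra k (Alphabet p k)) :=
  naturalAction (freeStructure (pszStructure p k m hm))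

lemma naturalAction_tmul {R Y L : Type*} [CommRing R] [CommRing Y] [Algebra R Y] [LieRing L]
    [LieAlgebra R L] {ψ : L →ₗ⁅R⁆ Wreath R Y L} {a b : L} {y : Y} (h : ψ a = Wreath.tmul y b)
    (x : Y) (w : TensorAlgebra R Y) :
    naturalAction ψ a (TensorAlgebra.ι R x * w) =
      TensorAlgebra.ι R (x * y) * naturalAction ψ b w := by
  rw [naturalAction_ι_mul, h]
  simp [Wreath.tmul]

lemma naturalAction_tmul_add {R Y L : Type*} [CommRing R] [CommRing Y] [Algebra R Y] [LieRing L]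
    [LieAlgebra R L] {ψ : L →ₗ⁅R⁆ Wreath R Y L} {a b b' : L} {y y' : Y}
    (h : ψ a = Wreath.tmul y b + Wreath.tmul y' b') (x : Y) (w : TensorAlgebra R Y) :
    naturalAction ψ a (TensorAlgebra.ι R x * w) =
      TensorAlgebra.ι R (x * y) * naturalAction ψ b w +
        TensorAlgebra.ι R (x * y') * naturalAction ψ b' w := by
  rw [naturalAction_ι_mul, h]
  simp [Wreath.tmul]

lemma naturalAction_der {R Y L : Type*} [CommRing R] [CommRing Y] [Algebra R Y] [LieRing L]
    [LieAlgebra R L] {ψ : L →ₗ⁅R⁆ Wreath R Y L} {a : L} {δ : Derivation R Y Y}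
    (h : ψ a = Wreath.der δ) (x : Y) (w : TensorAlgebra R Y) :
    naturalAction ψ a (TensorAlgebra.ι R x * w) = TensorAlgebra.ι R (δ x) * w := by
  rw [naturalAction_ι_mul, h]
  simp [Wreath.der]

lemma freeStructure_d_one (h₁ : 1 ≤ 1) (h₂ : 1 < m) :
    freeStructure (pszStructure p k m hm) (FreeLieAlgebra.of k (.d 1 h₁ h₂)) =
      Wreath.der (Alphabet.ddx p k) :=
  FreeLieAlgebra.lift_of_apply _ _

lemma freeStructure_d_add_two (n : ℕ) (h₁ : 1 ≤ n + 2) (h₂ : n + 2 < m) :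
    freeStructure (pszStructure p k m hm) (FreeLieAlgebra.of k (.d (n + 2) h₁ h₂)) =
      Wreath.tmul 1 (FreeLieAlgebra.of k (.d (n + 1) (by omega) (by omega))) :=
  FreeLieAlgebra.lift_of_apply _ _

lemma freeStructure_v :
    freeStructure (pszStructure p k m hm) (FreeLieAlgebra.of k .v) =
      Wreath.tmul 1 (FreeLieAlgebra.of k (.d (m - 1) (by omega) (by omega)))
        + Wreath.tmul (Alphabet.x p k ^ (p - 1)) (FreeLieAlgebra.of k .v) :=
  FreeLieAlgebra.lift_of_apply _ _

lemma realizes_d (n : ℕ) (h₁ : 1 ≤ n + 1) (h₂ : n + 1 < m) :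
    Realizes (partialDer p k[X] n) (pszAction p k hm (FreeLieAlgebra.of k (.d (n + 1) h₁ h₂))) := by
  induction n with
  | zero =>
    refine realizes_of_ι_mul (naturalAction_one _ _) fun y w _ => ?_
    rw [naturalAction_der (freeStructure_d_one p k hm _ _), derivation_realize_ι_mul,
      partialDer_zero_shift, partialDer_var_self, realize_ι_mul, mul_zero, zero_add, mul_one]
  | succ n ih =>
    refine realizes_of_ι_mul (naturalAction_one _ _) fun y w _ => ?_
    rw [naturalAction_tmul (freeStructure_d_add_two p k hm _ _ _), derivation_realize_ι_mul,
      partialDer_succ_shift, partialDer_var_of_ne (by omega), realize_ι_mul, ih _ (by omega),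
      mul_one, mul_zero, add_zero]

lemma realizes_v : Realizes (pivotDer p k[X] m) (pszAction p k hm (FreeLieAlgebra.of k .v)) := by
  refine realizes_of_ι_mul (naturalAction_one _ _) fun y w hw => ?_
  have hd := realizes_d p k hm (m - 2) (by omega) (by omega) w
  have hx : Alphabet.toTrunc p k (Alphabet.x p k) = var p k[X] 0 := by
    rw [Alphabet.x, Alphabet.toTrunc_mk, aeval_X]
  simp only [show m - 2 + 1 = m - 1 by omega] at hd
  rw [naturalAction_tmul_add (freeStructure_v p k hm), derivation_realize_ι_mul,
    pivotDer_shift hm, pivotDer_var_zero hm, map_add, realize_ι_mul, realize_ι_mul, hw, hd,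
    map_mul, map_mul, map_one, map_pow, hx]
  ring

lemma pszRestricted_le [Fact p.Prime] {lam : ℝ} (hlam1 : 1 < lam)
    (hlam : lam ^ (m - 1) * (lam - 1) = p - 1) :
    pszRestricted p k m hm ≤ boundedOperators p k hm hlam1 hlam := by
  refine sInf_le ⟨?_, fun A hA => pow_mem_boundedOperators hm hlam1 hlam hA⟩
  rintro _ ⟨_ | _, rfl⟩
  case d n h₁ h₂ =>
    obtain ⟨n, rfl⟩ : ∃ j, n = j + 1 := ⟨n - 1, by omega⟩
    exact ⟨_, _, lowersBy_partialDer hlam1.le n, realizes_d p k hm n h₁ h₂⟩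
  case v => exact ⟨_, _, lowersBy_pivotDer hm hlam1.le hlam, realizes_v p k hm⟩

lemma exists_weight_root [Fact p.Prime] (m : ℕ) :
    ∃ lam : ℝ, 1 < lam ∧ lam ^ (m - 1) * (lam - 1) = p - 1 := by
  have hp : (1 : ℝ) < p := by exact_mod_cast (Fact.out : p.Prime).one_lt
  have hcont : ContinuousOn (fun l : ℝ => l ^ (m - 1) * (l - 1)) (Set.Icc 1 p) := by fun_prop
  -- The function vanishes at `1` and is at least `p - 1` at `p`.
  obtain ⟨l, hl, h⟩ := intermediate_value_Icc hp.le hcont (show (p : ℝ) - 1 ∈ _ from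
    ⟨by simp only [sub_self, mul_zero]; linarith,
      le_mul_of_one_le_left (by linarith) (one_le_pow₀ hp.le)⟩)
  refine ⟨l, lt_of_le_of_ne hl.1 ?_, h⟩
  rintro rfl
  simp only [sub_self, mul_zero] at h
  linarith

theorem isNilpotent_of_mem_pszRestricted [Fact p.Prime]
    {A : Module.End k (TensorAlgebra k (Alphabet p k))} (hA : A ∈ pszRestricted p k m hm) :
    IsNilpotent A := by
  obtain ⟨lam, hlam1, hlam⟩ := exists_weight_root p m
  exact isNilpotent_of_mem_boundedOperators hm hlam1 hlam (pszRestricted_le p k hm hlam1 hlam hA)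

/-- By the universal property, the lift of the generators into `S`, followed by inclusion, is the
identity. -/
lemma mem_lieSubalgebra_of_forall_of_mem {R ι : Type*} [CommRing R]
    (S : LieSubalgebra R (FreeLieAlgebra R ι))
    (h : ∀ i, FreeLieAlgebra.of R i ∈ S) (a : FreeLieAlgebra R ι) : a ∈ S := by
  have : S.incl.comp (FreeLieAlgebra.lift R fun i => (⟨FreeLieAlgebra.of R i, h i⟩ : S)) =
      LieHom.id := FreeLieAlgebra.hom_ext fun i => by simp
  rw [← LieHom.id_apply (R := R) a, ← this]
  exact SetLike.coe_mem (FreeLieAlgebra.lift R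
    (fun i => (⟨FreeLieAlgebra.of R i, h i⟩ : S)) a)

lemma pszAction_mem_pszRestricted (a : FreeLieAlgebra k (Gen m)) :
    pszAction p k hm a ∈ pszRestricted p k m hm := by
  refine mem_lieSubalgebra_of_forall_of_mem ((pszRestricted p k m hm).comap (pszAction p k hm)) (fun i => ?_) a
  rw [LieSubalgebra.mem_comap, ← SetLike.mem_coe]
  simp only [definedRestrictedAlgebra, restrictedClosure, LieSubalgebra.coe_sInf, Set.mem_iInter]
  exact fun H hH => hH.1 ⟨i, rfl⟩

end Generators

end Operators

/-! ### Deleting the first letter of a tensor -/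

section TailMap

variable {R Y : Type*} [CommRing R] [CommRing Y] [Algebra R Y]

/-- The pair `(e, w) ↦ (ε y • w, y ⊗ w)`. -/
def tailStep (ε : Y →ₗ[R] R) : Y →ₗ[R] Module.End R (TensorAlgebra R Y × TensorAlgebra R Y) where
  toFun y := (ε y • LinearMap.snd R _ _).prod
    (LinearMap.mulLeft R (TensorAlgebra.ι R y) ∘ₗ LinearMap.snd R _ _)
  map_add' y z := by ext <;> simp [add_smul, add_mul]
  map_smul' c y := by ext <;> simp [mul_smul]

/-- A tensor `w` together with the result of applying `ε` to its first letter. -/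
def tailPair (ε : Y →ₗ[R] R) :
    TensorAlgebra R Y →ₗ[R] TensorAlgebra R Y × TensorAlgebra R Y :=
  LinearMap.applyₗ (0, 1) ∘ₗ (TensorAlgebra.lift R (tailStep ε)).toLinearMap

/-- The linear map `y ⊗ w ↦ ε y • w`, `1 ↦ 0`. -/
def tailMap (ε : Y →ₗ[R] R) : TensorAlgebra R Y →ₗ[R] TensorAlgebra R Y :=
  LinearMap.fst R _ _ ∘ₗ tailPair ε

variable (ε : Y →ₗ[R] R)

lemma tailMap_one : tailMap ε 1 = 0 := by
  simp [tailMap, tailPair]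

lemma tailPair_ι_mul (y : Y) (w : TensorAlgebra R Y) :
    tailPair ε (TensorAlgebra.ι R y * w) = tailStep ε y (tailPair ε w) := by
  simp [tailPair]

lemma tailPair_snd (w : TensorAlgebra R Y) : (tailPair ε w).2 = w := by
  induction w using tensor_induction with
  | one => simp [tailPair]
  | smul c w hw => simp [hw]
  | add v w hv hw => simp [hv, hw]
  | ι_mul x w hw => rw [tailPair_ι_mul]; simp [tailStep, hw]

lemma tailMap_ι_mul (y : Y) (w : TensorAlgebra R Y) :
    tailMap ε (TensorAlgebra.ι R y * w) = ε y • w := by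
  rw [tailMap, LinearMap.comp_apply, tailPair_ι_mul]
  simp [tailStep, tailPair_snd]

variable {L : Type*} [LieRing L] [LieAlgebra R L] {ψ : L →ₗ⁅R⁆ Wreath R Y L}

/-- Applying `ε` to the first letter kills the `z` term and turns `y` into the scalar `r`. The
images of all generators under `substitution` fit this shape, up to a scalar. -/
lemma tailMap_naturalAction_of_eq_tmul_add {a b c : L} {y z : Y} (r : R)
    (h : ψ a = Wreath.tmul y b + Wreath.tmul z c) (hy : ∀ x, ε (x * y) = ε x * r)
    (hz : ∀ x, ε (x * z) = 0) (w : TensorAlgebra R Y) :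
    tailMap ε (naturalAction ψ a w) = r • naturalAction ψ b (tailMap ε w) := by
  induction w using tensor_induction with
  | one => simp [naturalAction_one, tailMap_one]
  | smul s w hw => simp [hw, smul_comm r s]
  | add v w hv hw => simp [hv, hw]
  | ι_mul x w hw =>
    rw [naturalAction_tmul_add h, map_add, tailMap_ι_mul, tailMap_ι_mul, tailMap_ι_mul, hy, hz,
      zero_smul, add_zero, map_smul, smul_smul, mul_comm]

end TailMap

/-! ### Failure of nilpotency -/

section NotNilpotent

open Polynomial

variable (p : ℕ) (k : Type*) [Field k]

/-- The augmentation `x ↦ 0` of `k[x]/(x ^ p)`. -/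
def Alphabet.augmentation [Fact p.Prime] : Alphabet p k →ₐ[k] k :=
  Ideal.Quotient.liftₐ _ (Polynomial.aeval (0 : k)) <| by
    intro a ha
    obtain ⟨c, rfl⟩ := Ideal.mem_span_singleton.1 ha
    simp [(Fact.out : p.Prime).ne_zero]

lemma Alphabet.augmentation_mk [Fact p.Prime] (f : k[X]) :
    Alphabet.augmentation p k (Ideal.Quotient.mk _ f) = aeval (0 : k) f := rfl

lemma Alphabet.augmentation_x [Fact p.Prime] :
    Alphabet.augmentation p k (Alphabet.x p k) = 0 :=
  aeval_X (0 : k)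

variable {m : ℕ} (hm : 2 ≤ m)

/-! ### The substitution and the lower central series -/

/-- The first generator `d₁`. -/
abbrev genFirst : FreeLieAlgebra k (Gen m) := FreeLieAlgebra.of k (.d 1 le_rfl hm)

/-- The endomorphism `dₙ ↦ dₙ₊₁`, `d_{m-1} ↦ v`, `v ↦ (ad d₁) ^ (p - 1) v / (p - 1)!` of the free
Lie algebra. -/
def substitution : FreeLieAlgebra k (Gen m) →ₗ⁅k⁆ FreeLieAlgebra k (Gen m) :=
  FreeLieAlgebra.lift k fun
    | .d n _ _ => if h : n + 1 < m then FreeLieAlgebra.of k (.d (n + 1) (by omega) h)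
        else FreeLieAlgebra.of k .v
    | .v => (((p - 1).factorial : k)⁻¹) •
        (LieAlgebra.ad k _ (genFirst k hm) ^ (p - 1)) (FreeLieAlgebra.of k .v)

lemma substitution_d_of_lt {n : ℕ} (h₁ : 1 ≤ n) (h₂ : n < m) (h : n + 1 < m) :
    substitution p k hm (FreeLieAlgebra.of k (.d n h₁ h₂)) =
      FreeLieAlgebra.of k (.d (n + 1) (by omega) h) := by
  rw [substitution, FreeLieAlgebra.lift_of_apply]
  exact dif_pos h

lemma substitution_d_last (h₁ : 1 ≤ m - 1) (h₂ : m - 1 < m) :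
    substitution p k hm (FreeLieAlgebra.of k (.d (m - 1) h₁ h₂)) = FreeLieAlgebra.of k .v := by
  rw [substitution, FreeLieAlgebra.lift_of_apply]
  exact dif_neg (by omega)

lemma substitution_v : substitution p k hm (FreeLieAlgebra.of k .v) =
    (((p - 1).factorial : k)⁻¹) •
        (LieAlgebra.ad k _ (genFirst k hm) ^ (p - 1)) (FreeLieAlgebra.of k .v) := by
  rw [substitution, FreeLieAlgebra.lift_of_apply]

lemma iterate_substitution_lie (n : ℕ) (a b : FreeLieAlgebra k (Gen m)) :
    (substitution p k hm)^[n] ⁅a, b⁆ =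
      ⁅(substitution p k hm)^[n] a, (substitution p k hm)^[n] b⁆ := by
  induction n with
  | zero => rfl
  | succ n ih => simp only [Function.iterate_succ_apply', ih, LieHom.map_lie]

lemma iterate_substitution_smul (n : ℕ) (c : k) (a : FreeLieAlgebra k (Gen m)) :
    (substitution p k hm)^[n] (c • a) = c • (substitution p k hm)^[n] a := by
  induction n with
  | zero => rfl
  | succ n ih => simp only [Function.iterate_succ_apply', ih, map_smul]

/-- Since `p - 1 ≥ 1`, replacing `v` by a multiple of `(ad d₁)^(p-1) v` creates at least one new
outer bracket. -/
lemma iterate_substitution_v_mem_lowerCentralSeries [Fact p.Prime] (n : ℕ) :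
    (substitution p k hm)^[n] (FreeLieAlgebra.of k .v) ∈
      LieModule.lowerCentralSeries k (FreeLieAlgebra k (Gen m)) (FreeLieAlgebra k (Gen m)) n := by
  induction n with
  | zero => simp
  | succ n ih =>
    obtain ⟨q, hq⟩ : ∃ q, p - 1 = q + 1 :=
      ⟨p - 2, by have := (Fact.out : p.Prime).two_le; omega⟩
    have hpow : ∀ j, (substitution p k hm)^[n]
        ((LieAlgebra.ad k _ (genFirst k hm) ^ j) (FreeLieAlgebra.of k .v)) ∈
        LieModule.lowerCentralSeries k (FreeLieAlgebra k (Gen m)) (FreeLieAlgebra k (Gen m)) n := by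
      intro j
      induction j with
      | zero => simpa using ih
      | succ j ihj =>
        rw [pow_succ', Module.End.mul_apply, LieAlgebra.ad_apply, iterate_substitution_lie]
        exact LieSubmodule.lie_mem _ ihj
    rw [Function.iterate_succ_apply, substitution_v, iterate_substitution_smul, hq, pow_succ',
      Module.End.mul_apply, LieAlgebra.ad_apply, iterate_substitution_lie,
      LieModule.lowerCentralSeries_succ]
    exact SMulMemClass.smul_mem _ (LieSubmodule.lie_mem_lie (LieSubmodule.mem_top _) (hpow q))

variable [CharP k p]

lemma wreath_der_lie_tmul {R Y L : Type*} [CommRing R] [CommRing Y] [Algebra R Y] [LieRing L]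
    [LieAlgebra R L] (δ : Derivation R Y Y) (y : Y) (a : L) :
    ⁅(Wreath.der δ : Wreath R Y L), (Wreath.tmul y a : Wreath R Y L)⁆ = Wreath.tmul (δ y) a := by
  simp [Wreath.der, Wreath.tmul, LieAlgebra.SemiDirectSum.lie_eq_mk]

/-- As `d₁ ↦ ∂ₓ`, bracketing with `d₁` differentiates the first tensor factors. At `j = p - 1` only
`(p - 1)! ⊗ v` remains. -/
lemma freeStructure_ad_pow_v (j : ℕ) :
    freeStructure (pszStructure p k m hm)
        ((LieAlgebra.ad k _ (genFirst k hm) ^ j) (FreeLieAlgebra.of k .v)) =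
      Wreath.tmul (Ideal.Quotient.mk _ (derivative^[j] (1 : k[X])))
          (FreeLieAlgebra.of k (.d (m - 1) (by omega) (by omega))) +
        Wreath.tmul (Ideal.Quotient.mk _ (derivative^[j] ((X : k[X]) ^ (p - 1))))
          (FreeLieAlgebra.of k .v) := by
  induction j with
  | zero => exact freeStructure_v p k hm
  | succ j ih =>
    rw [pow_succ', Module.End.mul_apply, LieAlgebra.ad_apply, LieHom.map_lie, ih,
      freeStructure_d_one, lie_add, wreath_der_lie_tmul, wreath_der_lie_tmul, Alphabet.ddx_mk,
      Alphabet.ddx_mk, Function.iterate_succ_apply', Function.iterate_succ_apply']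

variable [Fact p.Prime]

/-- Setting the first variable to zero turns the operator of `φ a` into that of `a`. -/
lemma tailMap_pszAction_substitution (a : FreeLieAlgebra k (Gen m)) :
    tailMap (Alphabet.augmentation p k).toLinearMap ∘ₗ
        pszAction p k hm (substitution p k hm a) =
      pszAction p k hm a ∘ₗ tailMap (Alphabet.augmentation p k).toLinearMap := by
  set e := tailMap (Alphabet.augmentation p k).toLinearMap
  have hp := (Fact.out : p.Prime).two_le
  have hfac : ((p - 1).factorial : k) ≠ 0 := by
    rw [Ne, CharP.cast_eq_zero_iff k p, (Fact.out : p.Prime).dvd_factorial]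
    omega
  let S : LieSubalgebra k (FreeLieAlgebra k (Gen m)) :=
    { carrier := {a | e ∘ₗ pszAction p k hm (substitution p k hm a) = pszAction p k hm a ∘ₗ e}
      zero_mem' := by simp
      add_mem' := fun {a b} ha hb => by
        simp only [Set.mem_ofPred_eq] at ha hb ⊢
        rw [map_add, map_add, map_add, LinearMap.comp_add, LinearMap.add_comp, ha, hb]
      smul_mem' := fun c a ha => by
        simp only [Set.mem_ofPred_eq] at ha ⊢
        rw [map_smul, map_smul, map_smul, LinearMap.comp_smul, LinearMap.smul_comp, ha]
      lie_mem' := fun {a b} ha hb => by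
        simp only [Set.mem_ofPred_eq] at ha hb ⊢
        simp only [LieHom.map_lie, LieRing.of_associative_ring_bracket, LinearMap.comp_sub,
          LinearMap.sub_comp, Module.End.mul_eq_comp]
        rw [← LinearMap.comp_assoc, ← LinearMap.comp_assoc, ha, hb, LinearMap.comp_assoc,
          LinearMap.comp_assoc, ha, hb, LinearMap.comp_assoc, LinearMap.comp_assoc] }
  refine mem_lieSubalgebra_of_forall_of_mem S (fun i => LinearMap.ext fun w => ?_) a
  rw [LinearMap.comp_apply, LinearMap.comp_apply]
  cases i with
  | d n h₁ h₂ =>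
    by_cases h : n + 1 < m
    · obtain ⟨n, rfl⟩ : ∃ j, n = j + 1 := ⟨n - 1, by omega⟩
      rw [substitution_d_of_lt p k hm h₁ h₂ h]
      have := tailMap_naturalAction_of_eq_tmul_add (Alphabet.augmentation p k).toLinearMap 1
        (b := FreeLieAlgebra.of k (.d (n + 1) h₁ h₂)) (c := 0) (y := 1) (z := 0)
        ((freeStructure_d_add_two p k hm n (by omega) h).trans
          (by simp [Wreath.tmul])) (by simp) (by simp) w
      simpa using this
    · obtain rfl : n = m - 1 := by omega
      rw [substitution_d_last]
      -- The `v` term disappears because the augmentation kills `x ^ (p - 1)`, the exponent being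
      -- positive.
      have := tailMap_naturalAction_of_eq_tmul_add (Alphabet.augmentation p k).toLinearMap 1
        (freeStructure_v p k hm) (by simp) (by simp [Alphabet.augmentation_x]; omega) w
      simpa using this
  | v =>
    rw [substitution_v]
    have h := freeStructure_ad_pow_v p k hm (p - 1)
    -- Here the surviving summand is the one with `v`, so it has to come first.
    rw [add_comm] at h
    have := tailMap_naturalAction_of_eq_tmul_add (Alphabet.augmentation p k).toLinearMap
        ((p - 1).factorial : k) h ?_ ?_ w
    · rw [map_smul, LinearMap.smul_apply, map_smul]
      change _ • tailMap (Alphabet.augmentation p k).toLinearMap (naturalAction _ _ _) = _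
      rw [this, smul_smul, inv_mul_cancel₀ hfac, one_smul]
    · intro x
      rw [Polynomial.iterate_derivative_X_pow_eq_smul, Nat.sub_self, pow_zero, Nat.descFactorial_self,
        AlgHom.toLinearMap_apply, map_mul, Alphabet.augmentation_mk, map_smul, map_one, smul_eq_mul,
        mul_one]
      rfl
    · intro x
      rw [Polynomial.iterate_derivative_one (by omega)]
      simp

/-- The intertwining map is onto: it sends `1 ⊗ w` to `w`. -/
lemma pszAction_ne_zero_of_substitution {a : FreeLieAlgebra k (Gen m)}
    (h : pszAction p k hm (substitution p k hm a) = 0) : pszAction p k hm a = 0 := by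
  have h1 := tailMap_pszAction_substitution p k hm a
  rw [h, LinearMap.comp_zero] at h1
  ext1 w
  have h2 := congr($h1 (TensorAlgebra.ι k 1 * w))
  rw [LinearMap.comp_apply, tailMap_ι_mul] at h2
  simpa using h2.symm

lemma pszAction_genFirst_ne_zero : pszAction p k hm (genFirst k hm) ≠ 0 := by
  intro h
  have h1 := congr($h (TensorAlgebra.ι k (Alphabet.x p k) * 1))
  rw [naturalAction_der (freeStructure_d_one p k hm _ _), mul_one, Alphabet.x, Alphabet.ddx_mk,
    derivative_X, map_one, LinearMap.zero_apply] at h1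
  have h2 := congr(tailMap (Alphabet.augmentation p k).toLinearMap ($h1 * 1))
  rw [tailMap_ι_mul] at h2
  simp at h2

/-- The substitution carries `d₁` through all the `dₙ` to `v`, so nonvanishing propagates from `d₁`.
-/
lemma pszAction_v_ne_zero : pszAction p k hm (FreeLieAlgebra.of k .v) ≠ 0 := by
  have hd : ∀ n (h₁ : 1 ≤ n) (h₂ : n < m),
      pszAction p k hm (FreeLieAlgebra.of k (.d n h₁ h₂)) ≠ 0 := by
    intro n h₁
    induction n, h₁ using Nat.le_induction with
    | base => exact fun _ => pszAction_genFirst_ne_zero p k hm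
    | succ n h₁ ih =>
      intro h₂ h
      rw [← substitution_d_of_lt p k hm h₁ (by omega) h₂] at h
      exact ih _ (pszAction_ne_zero_of_substitution p k hm h)
  intro h
  rw [← substitution_d_last p k hm (by omega) (by omega)] at h
  exact hd _ _ _ (pszAction_ne_zero_of_substitution p k hm h)

lemma pszAction_iterate_substitution_v_ne_zero (n : ℕ) :
    pszAction p k hm ((substitution p k hm)^[n] (FreeLieAlgebra.of k .v)) ≠ 0 := by
  induction n with
  | zero => exact pszAction_v_ne_zero p k hm
  | succ n ih =>
    rw [Function.iterate_succ_apply']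
    exact fun h => ih (pszAction_ne_zero_of_substitution p k hm h)

lemma not_isNilpotent_range_pszAction : ¬ LieRing.IsNilpotent (pszAction p k hm).range := by
  intro h
  obtain ⟨n, hn⟩ := (LieModule.isNilpotent_iff k _ _).1 h
  have h1 := LieIdeal.map_lowerCentralSeries_le n (f := (pszAction p k hm).rangeRestrict)
    (LieIdeal.mem_map (iterate_substitution_v_mem_lowerCentralSeries p k hm n))
  rw [hn, LieSubmodule.mem_bot] at h1
  exact pszAction_iterate_substitution_v_ne_zero p k hm n (congrArg Subtype.val h1)

/-! ### Transfer to the two algebras -/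

theorem not_isNilpotent_pszPlain : ¬ LieRing.IsNilpotent (PSZPlain p k m hm) := fun _ =>
  not_isNilpotent_range_pszAction p k hm
    (LieHom.quotKerEquivRange (pszAction p k hm)).symm.injective.lieAlgebra_isNilpotent

omit [Fact p.Prime] in
lemma range_pszAction_le : (pszAction p k hm).range ≤ pszRestricted p k m hm := by
  rintro _ ⟨a, rfl⟩
  exact pszAction_mem_pszRestricted p k hm a

theorem not_isNilpotent_pszRestricted : ¬ LieRing.IsNilpotent (pszRestricted p k m hm) := fun _ =>
  not_isNilpotent_range_pszAction p k hm
    (LieSubalgebra.inclusion_injective (range_pszAction_le p k hm)).lieAlgebra_isNilpotent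

theorem isAdNil_pszRestricted : IsAdNil k (pszRestricted p k m hm) := fun a =>
  LieAlgebra.isNilpotent_ad_of_isNilpotent (isNilpotent_of_mem_pszRestricted p k hm a.2)

lemma isAdNil_of_injective {R L L' : Type*} [CommRing R] [LieRing L] [LieAlgebra R L] [LieRing L']
    [LieAlgebra R L'] {f : L →ₗ⁅R⁆ L'} (hf : Function.Injective f) (h : IsAdNil R L') :
    IsAdNil R L := by
  intro a
  obtain ⟨n, hn⟩ := h (f a)
  have hpow : ∀ j b, f ((LieAlgebra.ad R L a ^ j) b) = (LieAlgebra.ad R L' (f a) ^ j) (f b) := by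
    intro j b
    induction j with
    | zero => rfl
    | succ j ih =>
      rw [pow_succ', pow_succ', Module.End.mul_apply, Module.End.mul_apply, ← ih,
        LieAlgebra.ad_apply, LieAlgebra.ad_apply, LieHom.map_lie]
  refine ⟨n, LinearMap.ext fun b => hf ?_⟩
  rw [hpow, hn, LinearMap.zero_apply, LinearMap.zero_apply, map_zero]

theorem isAdNil_pszPlain : IsAdNil k (PSZPlain p k m hm) :=
  isAdNil_of_injective
    (f := (LieHom.quotKerEquivRange (pszAction p k hm)).toLieHom)
    (LieHom.quotKerEquivRange (pszAction p k hm)).injective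
    (isAdNil_of_injective (LieSubalgebra.inclusion_injective (range_pszAction_le p k hm))
      (isAdNil_pszRestricted p k hm))

end NotNilpotent

end SelfSimilar

end

theorem mainTheorem4 (p : ℕ) [Fact p.Prime] (k : Type*) [Field k] [CharP k p]
    (m : ℕ) (hm : 2 ≤ m) :
    ((∀ a ∈ SelfSimilar.pszRestricted p k m hm, ∃ n : ℕ, a ^ p ^ n = 0) ∧
      SelfSimilar.IsAdNil k (SelfSimilar.pszRestricted p k m hm) ∧
      ¬ LieRing.IsNilpotent (SelfSimilar.pszRestricted p k m hm)) ∧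
    (SelfSimilar.IsAdNil k (SelfSimilar.PSZPlain p k m hm) ∧
      ¬ LieRing.IsNilpotent (SelfSimilar.PSZPlain p k m hm)) := by
  refine ⟨⟨fun a ha => ?_, SelfSimilar.isAdNil_pszRestricted p k hm,
    SelfSimilar.not_isNilpotent_pszRestricted p k hm⟩, SelfSimilar.isAdNil_pszPlain p k hm,
    SelfSimilar.not_isNilpotent_pszPlain p k hm⟩
  obtain ⟨n, hn⟩ := SelfSimilar.isNilpotent_of_mem_pszRestricted p k hm ha
  -- The nilpotency exponent `n` also serves for `p`-powers, since `n < p ^ n`.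
  exact ⟨n, pow_eq_zero_of_le (Nat.lt_pow_self (Fact.out : p.Prime).one_lt).le hn⟩
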